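/- **Relations and structures.** Let RCC8 $=\{\mathsf{dc},\mathsf{ec},\mathsf{po},\mathsf{eq},\mathsf{tpp},\mathsf{ntpp},\mathsf{tppi},\mathsf{ntppi}\}$. A *region structure* is a non-empty set $W$ with eight binary relations named by RCC8 that are mutually disjoint and jointly exhaustive on $W$, such that $\mathsf{eq}$ is the identity, $\mathsf{dc},\mathsf{ec},\mathsf{po}$ are symmetric, $\mathsf{tppi},\mathsf{ntppi}$ are the inverses of $\mathsf{tpp},\mathsf{ntpp}$, and all rules of the standard RCC8 composition table hold. $\mathcal{RS}$ is the class of all region structures. For a topological space $X$ and a set $U$ of non-empty regular closed subsets of $X$ (i.e. $\overline{s^\circ}=s$), $\mathfrak R(X,U)$ is the structure with domain $U$ in which $s\,\mathsf{dc}\,t$ iff $s\cap t=\emptyset$; $s\,\mathsf{ec}\,t$ iff $s^\circ\cap t^\circ=\emptyset$ and $s\cap t\ne\emptyset$; $s\,\mathsf{po}\,t$ iff $s^\circ\cap t^\circ\neq\emptyset$, $s\not\subseteq t$, $t\not\subseteq s$; $s\,\mathsf{eq}\,t$ iff $s=t$; $s\,\mathsf{tpp}\,t$ iff $s\subseteq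 t$, $s\not\subseteq t^\circ$, $s\ne t$; $s\,\mathsf{ntpp}\,t$ iff $s\subseteq t^\circ$, $s\neq t$; and $\mathsf{tppi},\mathsf{ntppi}$ are the inverses of $\mathsf{tpp},\mathsf{ntpp}$. Let $\mathbb R^n_{\mathrm{reg}}$ be the set of non-empty regular closed subsets of $\mathbb R^n$, $\mathbb R^n_{\mathrm{conv}}$ the set of convex ones among them, and $\mathbb R^n_{\mathrm{rect}}$ the set of closed hyper-rectangles, i.e. products of $n$ non-empty, non-singleton closed (bounded or unbounded) intervals of $\mathbb R$. Let $\mathcal{TOP}$ be the class of all structures $\mathfrak R(X,U)$ with $X$ a non-empty topological space and $U$ the set of all its non-empty regular closed subsets. **Logics.** Formulas are built from variables $p_0,p_1,\dots$ by $\neg$, $\wedge$ and boxes $[\mathsf r]$, $\mathsf r\in$ RCC8. In a structure with an arbitrary valuation of the variables by sets of regions, truth at a region is defined as usual, $[\mathsf r]\varphi$ being true at $s$ iff $\varphi$ is true at all $t$ with $s\,\mathsf r\,t$. $L(\mathcal S)$ is the set of formulas that are true at every region of every model based on a structure in $\mathcal S$, and $L^{\mathsf S}(\mathcal S)$ is the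 logic of the class of all (non-empty) substructures of structures in $\mathcal S$. A logic is *undecidable* if no algorithm decides whether a given formula belongs to it. **Domino ready.** Let $\lambda(1),\lambda(2),\dots$ be the enumeration $(0,0),(1,0),(0,1),(2,0),(1,1),(0,2),(3,0),\dots$ of $\mathbb N^2$ along the diagonals. A region structure is *domino ready* if it has sequences of regions $x_1,x_2,\dots$ and $y_1,y_2,\dots$ such that for all $i,j\ge1$: $x_i\,\mathsf{tpp}\,x_{i+1}$; $x_i\,\mathsf{ntpp}\,x_j$ if $j>i+1$; $x_{2i-1}\,\mathsf{tpp}\,y_i$; $y_i\,\mathsf{tpp}\,x_{2j-1}$ iff $\lambda(j)=\lambda(i)+(1,0)$; $y_i\,\mathsf{ntpp}\,y_j$ if $j>i$. **Theorem.** 1. If $\mathcal S\subseteq\mathcal{RS}$ contains a domino ready structure, then $L(\mathcal S)$ and $L^{\mathsf S}(\mathcal S)$ are undecidable. 2. If $\mathcal S\subseteq\mathcal{RS}$ contains (an isomorphic copy of) $\mathfrak R(\mathbb R^n,U)$ for some $n>0$ and some $U$ with $\mathbb R^n_{\mathrm{rect}}\subseteq U\subseteq\mathbb R^n_{\mathrm{reg}}$,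 then $L(\mathcal S)$ and $L^{\mathsf S}(\mathcal S)$ are undecidable. 3. In particular $L(\mathcal S)$ and $L^{\mathsf S}(\mathcal S)$ are undecidable for $\mathcal S=\mathcal{RS}$, for $\mathcal S=\mathcal{TOP}$, and for $\mathcal S=\{\mathfrak R(\mathbb R^n,U)\}$ with $n>0$ and $U$ one of $\mathbb R^n_{\mathrm{reg}},\mathbb R^n_{\mathrm{conv}},\mathbb R^n_{\mathrm{rect}}$; for $n=1$ and $U=\mathbb R_{\mathrm{rect}}=\mathbb R_{\mathrm{conv}}$ these are the full and substructure logics of intervals of the real line. -/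

import Mathlib

universe u v

namespace RegionLogic

/-! ### The eight relations and region structures -/

/-- The names of the eight Egenhofer-Franzosa (RCC8) relations. -/
inductive RCC8 : Type
  | dc | ec | po | eq | tpp | ntpp | tppi | ntppi

/-- A relational structure with one binary relation for each RCC8 name. -/
structure RelStructure : Type (u + 1) where
  /-- the domain of regions -/
  carrier : Type u
  /-- the interpretation of the eight relation symbols -/
  rel : RCC8 → carrier → carrier → Prop

open RCC8 in
/-- The RCC8 composition table: the list of the relations that are possible between `x` and `z`
when `r₁` holds between `x` and `y` and `r₂` holds between `y` and `z`. The rows and columns of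
`eq`, which the usual table omits, are the trivial ones; the starred entries are the lists of all
eight relations. -/
def compTable : RCC8 → RCC8 → List RCC8
  | eq, r => [r]
  | r, eq => [r]
  | dc, dc => [dc, ec, po, eq, tpp, ntpp, tppi, ntppi]
  | dc, ec => [dc, ec, po, tpp, ntpp]
  | dc, tpp => [dc, ec, po, tpp, ntpp]
  | dc, tppi => [dc]
  | dc, po => [dc, ec, po, tpp, ntpp]
  | dc, ntpp => [dc, ec, po, tpp, ntpp]
  | dc, ntppi => [dc]
  | ec, dc => [dc, ec, po, tppi, ntppi]
  | ec, ec => [dc, ec, po, tpp, tppi, eq]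
  | ec, tpp => [ec, po, tpp, ntpp]
  | ec, tppi => [dc, ec]
  | ec, po => [dc, ec, po, tpp, ntpp]
  | ec, ntpp => [po, tpp, ntpp]
  | ec, ntppi => [dc]
  | tpp, dc => [dc]
  | tpp, ec => [dc, ec]
  | tpp, tpp => [tpp, ntpp]
  | tpp, tppi => [dc, ec, po, tpp, tppi, eq]
  | tpp, po => [dc, ec, po, tpp, ntpp]
  | tpp, ntpp => [ntpp]
  | tpp, ntppi => [dc, ec, po, tppi, ntppi]
  | tppi, dc => [dc, ec, po, tppi, ntppi]
  | tppi, ec => [ec, po, tppi, ntppi]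
  | tppi, tpp => [po, eq, tpp, tppi]
  | tppi, tppi => [tppi, ntppi]
  | tppi, po => [po, tppi, ntppi]
  | tppi, ntpp => [po, tpp, ntpp]
  | tppi, ntppi => [ntppi]
  | po, dc => [dc, ec, po, tppi, ntppi]
  | po, ec => [dc, ec, po, tppi, ntppi]
  | po, tpp => [po, tpp, ntpp]
  | po, tppi => [dc, ec, po, tppi, ntppi]
  | po, po => [dc, ec, po, eq, tpp, ntpp, tppi, ntppi]
  | po, ntpp => [po, tpp, ntpp]
  | po, ntppi => [dc, ec, po, tppi, ntppi]
  | ntpp, dc => [dc]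
  | ntpp, ec => [dc]
  | ntpp, tpp => [ntpp]
  | ntpp, tppi => [dc, ec, po, tpp, ntpp]
  | ntpp, po => [dc, ec, po, tpp, ntpp]
  | ntpp, ntpp => [ntpp]
  | ntpp, ntppi => [dc, ec, po, eq, tpp, ntpp, tppi, ntppi]
  | ntppi, dc => [dc, ec, po, tppi, ntppi]
  | ntppi, ec => [po, tppi, ntppi]
  | ntppi, tpp => [po, tppi, ntppi]
  | ntppi, tppi => [ntppi]
  | ntppi, po => [po, tppi, ntppi]
  | ntppi, ntpp => [po, tppi, tpp, ntpp, ntppi, eq]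
  | ntppi, ntppi => [ntppi]

/-- A (general) region structure: a non-empty domain with eight mutually disjoint and jointly
exhaustive relations, `eq` being the identity, `dc`, `ec`, `po` symmetric, `tppi` and `ntppi` the
inverses of `tpp` and `ntpp`, such that all rules of the composition table hold. -/
structure IsRegionStructure (R : RelStructure.{u}) : Prop where
  nonempty : Nonempty R.carrier
  disjoint : ∀ r q x y, R.rel r x y → R.rel q x y → r = q
  exhaustive : ∀ x y, ∃ r, R.rel r x y
  eq_iff : ∀ x y, R.rel RCC8.eq x y ↔ x = y
  dc_symm : ∀ x y, R.rel RCC8.dc x y → R.rel RCC8.dc y x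
  ec_symm : ∀ x y, R.rel RCC8.ec x y → R.rel RCC8.ec y x
  po_symm : ∀ x y, R.rel RCC8.po x y → R.rel RCC8.po y x
  tppi_iff : ∀ x y, R.rel RCC8.tppi x y ↔ R.rel RCC8.tpp y x
  ntppi_iff : ∀ x y, R.rel RCC8.ntppi x y ↔ R.rel RCC8.ntpp y x
  comp : ∀ r₁ r₂ x y z, R.rel r₁ x y → R.rel r₂ y z → ∃ q ∈ compTable r₁ r₂, R.rel q x z

/-- The class of all region structures (with domain in the given universe). -/
def RS : Set RelStructure.{u} := {R | IsRegionStructure R}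

/-- The substructure of `R` with domain `V`. -/
def RelStructure.restrict (R : RelStructure.{u}) (V : Set R.carrier) : RelStructure.{u} where
  carrier := V
  rel r x y := R.rel r x.1 y.1

/-- The class of all (non-empty) substructures of structures in `S`. -/
def substructures (S : Set RelStructure.{u}) : Set RelStructure.{u} :=
  {R' | ∃ R ∈ S, ∃ V : Set R.carrier, V.Nonempty ∧ R' = R.restrict V}

/-- Two structures, possibly in different universes, are isomorphic. -/
def RelStructure.Isomorphic (R : RelStructure.{u}) (R' : RelStructure.{v}) : Prop :=
  ∃ e : R.carrier ≃ R'.carrier, ∀ r x y, R.rel r x y ↔ R'.rel r (e x) (e y)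

/-! ### Concrete region structures -/

/-- The RCC8 relations between subsets of a topological space. -/
def topRel {X : Type u} [TopologicalSpace X] : RCC8 → Set X → Set X → Prop
  | RCC8.dc, s, t => s ∩ t = ∅
  | RCC8.ec, s, t => interior s ∩ interior t = ∅ ∧ s ∩ t ≠ ∅
  | RCC8.po, s, t => interior s ∩ interior t ≠ ∅ ∧ ¬ s ⊆ t ∧ ¬ t ⊆ s
  | RCC8.eq, s, t => s = t
  | RCC8.tpp, s, t => s ⊆ t ∧ ¬ s ⊆ interior t ∧ s ≠ t
  | RCC8.ntpp, s, t => s ⊆ interior t ∧ s ≠ t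
  | RCC8.tppi, s, t => t ⊆ s ∧ ¬ t ⊆ interior s ∧ t ≠ s
  | RCC8.ntppi, s, t => t ⊆ interior s ∧ t ≠ s

/-- The concrete region structure induced by a topological space `X` and a set `U` of regions. -/
def concrete {X : Type u} [TopologicalSpace X] (U : Set (Set X)) : RelStructure.{u} where
  carrier := U
  rel r s t := topRel r s.1 t.1

/-- The set of all non-empty regular closed subsets of a topological space. -/
def regSets (X : Type u) [TopologicalSpace X] : Set (Set X) :=
  {s | s.Nonempty ∧ closure (interior s) = s}

/-- The class of the structures given by all non-empty regular closed subsets of a non-empty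
topological space. -/
def TOP : Set RelStructure.{u} :=
  {R | ∃ (X : Type u) (_ : TopologicalSpace X) (_ : Nonempty X), R = concrete (regSets X)}

/-- Non-empty convex regular closed subsets of Euclidean space. -/
def convSets (n : ℕ) : Set (Set (EuclideanSpace ℝ (Fin n))) :=
  {s | s ∈ regSets (EuclideanSpace ℝ (Fin n)) ∧ Convex ℝ s}

/-- Closed hyper-rectangles: products of non-empty, non-singleton, closed (bounded or unbounded)
intervals of the real line. -/
def rectSets (n : ℕ) : Set (Set (EuclideanSpace ℝ (Fin n))) :=
  {s | ∃ C : Fin n → Set ℝ,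
    (∀ i, IsClosed (C i) ∧ (C i).OrdConnected ∧ (C i).Nontrivial) ∧ s = {x | ∀ i, x i ∈ C i}}

/-! ### The modal language -/

/-- Formulas of the modal language with a modal box for each RCC8 relation. -/
inductive Formula : Type
  | var : ℕ → Formula
  | neg : Formula → Formula
  | and : Formula → Formula → Formula
  | box : RCC8 → Formula → Formula

/-- Truth of a formula at a region, in the region model that consists of a structure `R` and a
valuation `V` of the propositional variables. -/
def Sat (R : RelStructure.{u}) (V : ℕ → Set R.carrier) : R.carrier → Formula → Prop
  | s, Formula.var i => s ∈ V i
  | s, Formula.neg φ => ¬ Sat R V s φ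
  | s, Formula.and φ ψ => Sat R V s φ ∧ Sat R V s ψ
  | s, Formula.box r φ => ∀ t, R.rel r s t → Sat R V t φ

/-- The logic of a class of structures: the set of all formulas that are true at every region of
every model based on a structure of the class. -/
def logic (S : Set RelStructure.{u}) : Set Formula :=
  {φ | ∀ R ∈ S, ∀ (V : ℕ → Set R.carrier) (s : R.carrier), Sat R V s φ}

/-- The substructure logic of a class of structures. -/
def subLogic (S : Set RelStructure.{u}) : Set Formula :=
  logic (substructures S)

/-! ### An effective numbering of the formulas, and undecidability -/

/-- Numbering of the relation names by `0, …, 7`. -/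
def RCC8.toIndex : RCC8 → ℕ
  | dc => 0 | ec => 1 | po => 2 | eq => 3 | tpp => 4 | ntpp => 5 | tppi => 6 | ntppi => 7

/-- The inverse of `RCC8.toIndex` on `0, …, 7`. -/
def RCC8.ofIndex : ℕ → RCC8
  | 0 => dc | 1 => ec | 2 => po | 3 => eq | 4 => tpp | 5 => ntpp | 6 => tppi | _ => ntppi

/-- The Gödel number of a formula. -/
def Formula.code : Formula → ℕ
  | var i => 4 * i
  | neg φ => 4 * φ.code + 1
  | and φ ψ => 4 * Nat.pair φ.code ψ.code + 2
  | box r φ => 4 * (8 * φ.code + r.toIndex) + 3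

/-- The formula with a given Gödel number. -/
def Formula.decode (n : ℕ) : Formula :=
  if h0 : n % 4 = 0 then var (n / 4)
  else if n % 4 = 1 then neg (decode (n / 4))
  else if n % 4 = 2 then and (decode (n / 4).unpair.1) (decode (n / 4).unpair.2)
  else box (RCC8.ofIndex (n / 4 % 8)) (decode (n / 4 / 8))
termination_by n
decreasing_by
  · omega
  · exact lt_of_le_of_lt (Nat.unpair_left_le _) (by omega)
  · exact lt_of_le_of_lt (Nat.unpair_right_le _) (by omega)
  · omega

theorem RCC8.toIndex_lt (r : RCC8) : r.toIndex < 8 := by cases r <;> decide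

theorem RCC8.ofIndex_toIndex (r : RCC8) : RCC8.ofIndex r.toIndex = r := by cases r <;> rfl

theorem RCC8.toIndex_ofIndex (n : ℕ) (h : n < 8) : (RCC8.ofIndex n).toIndex = n := by
  interval_cases n <;> rfl

theorem Formula.decode_code (φ : Formula) : Formula.decode φ.code = φ := by
  induction φ with
  | var i =>
    rw [Formula.code, Formula.decode, dif_pos (by omega)]
    congr 1; omega
  | neg φ ih =>
    have h : (4 * φ.code + 1) / 4 = φ.code := by omega
    rw [Formula.code, Formula.decode, dif_neg (by omega), if_pos (by omega), h, ih]
  | and φ ψ ih₁ ih₂ =>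
    have h : (4 * Nat.pair φ.code ψ.code + 2) / 4 = Nat.pair φ.code ψ.code := by omega
    rw [Formula.code, Formula.decode, dif_neg (by omega), if_neg (by omega), if_pos (by omega), h,
      Nat.unpair_pair, ih₁, ih₂]
  | box r φ ih =>
    have hr := r.toIndex_lt
    have h : (4 * (8 * φ.code + r.toIndex) + 3) / 4 = 8 * φ.code + r.toIndex := by omega
    have h₁ : (8 * φ.code + r.toIndex) / 8 = φ.code := by omega
    have h₂ : (8 * φ.code + r.toIndex) % 8 = r.toIndex := by omega
    rw [Formula.code, Formula.decode, dif_neg (by omega), if_neg (by omega), if_neg (by omega), h,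
      h₁, h₂, ih, RCC8.ofIndex_toIndex]

theorem Formula.code_decode (n : ℕ) : (Formula.decode n).code = n := by
  induction n using Nat.strong_induction_on with
  | _ n ih =>
    rw [Formula.decode]
    split_ifs with h0 h1 h2
    · rw [Formula.code]; omega
    · rw [Formula.code, ih _ (by omega)]; omega
    · have hl : (n / 4).unpair.1 < n := lt_of_le_of_lt (Nat.unpair_left_le _) (by omega)
      have hr : (n / 4).unpair.2 < n := lt_of_le_of_lt (Nat.unpair_right_le _) (by omega)
      rw [Formula.code, ih _ hl, ih _ hr, Nat.pair_unpair]; omega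
    · rw [Formula.code, ih _ (by omega), RCC8.toIndex_ofIndex _ (by omega)]; omega

/-- The Gödel numbering as a bijection. -/
def Formula.equivNat : Formula ≃ ℕ where
  toFun := Formula.code
  invFun := Formula.decode
  left_inv := Formula.decode_code
  right_inv := Formula.code_decode

/-- Computability over formulas refers to the Gödel numbering. -/
instance : Denumerable Formula := Denumerable.mk' Formula.equivNat

/-- A set of formulas is undecidable if no algorithm decides membership of a given formula. -/
def Undecidable (L : Set Formula) : Prop := ¬ ComputablePred (fun φ : Formula => φ ∈ L)

/-! ### Domino ready structures -/

/-- The diagonal enumeration of the first quadrant, counted from `1`: each diagonal is run through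
from the floor `ℕ × {0}` up to the wall `{0} × ℕ`, so that the positions numbered `1, 2, 3, 4, …`
are `(0,0), (1,0), (0,1), (2,0), (1,1), (0,2), (3,0), …` (the value at `0` is never used). -/
def tilePos : ℕ → ℕ × ℕ
  | 0 => (0, 0)
  | 1 => (0, 0)
  | n + 2 =>
    match tilePos (n + 1) with
    | (0, b) => (b + 1, 0)
    | (a + 1, b) => (a, b + 1)

/-- Domino ready structures. The sequences are indexed by the positive integers. -/
def DominoReady (R : RelStructure.{u}) : Prop :=
  ∃ x y : ℕ → R.carrier, ∀ i j : ℕ, 1 ≤ i → 1 ≤ j →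
    R.rel RCC8.tpp (x i) (x (i + 1)) ∧
    (i + 1 < j → R.rel RCC8.ntpp (x i) (x j)) ∧
    R.rel RCC8.tpp (x (2 * i - 1)) (y i) ∧
    (R.rel RCC8.tpp (y i) (x (2 * j - 1)) ↔ tilePos j = ((tilePos i).1 + 1, (tilePos i).2)) ∧
    (i < j → R.rel RCC8.ntpp (y i) (y j))

end RegionLogic

open RegionLogic

/-!
The proof reduces the halting problem to satisfiability. A tile system is a finite set of tiles with
relations for horizontal and for vertical neighbours, and the problem is whether the first quadrant
has a tiling whose bottom row starts with a given word. Its undecidability is not in Mathlib. It is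
obtained here from Mathlib's simulation of partial recursive functions by one-tape machines
(`exists_turingMachine`): the rows of a tiling are the successive configurations of a machine,
with the tape folded at the head (`tiles_inputWord_iff`). The input `2 ^ (n + 1)`, in binary, is a
word with a long constant part, which makes the reduction easy to compute.

The formula of a tile system (`TileSystem.localFormula`) marks regions as cells (`0`) and as two
kinds of intermediate regions (`1` and `2`). A link `tpp`-`tpp` through a region marked `1` leads
from a cell to its successor, and one through a region marked `2` to its right neighbour; the cell
above is the successor of the right neighbour. On a domino ready structure, with the cells
`x (2 * i - 1)` and the intermediate regions `x (2 * i)` and `y i`, these are the successor in the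
diagonal enumeration of the quadrant and the genuine neighbours to the right and above, so that
every tiling gives a model (`DominoSequences.tilingModel`).

Conversely, a model on any region structure gives a tiling as soon as the steps to the right and up
commute (`TilingModel.tiles`). The formula makes the cells linearly ordered by `ntpp`. The
composition table then shows that the right neighbour is a strictly monotone function and that the
successor is the least cell above the given one. Since all cells outside the wall are right
neighbours, and steps up from outside the wall stay outside it, the right neighbour of the
successor of a non-wall cell is the successor of its right neighbour
(`TilingModel.right_succ_comm`). It is not needed that the cells of the model are enumerated by the natural numbers.

For the concrete structures, the composition table follows from a few laws of contact, overlap and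
parthood of regular closed sets (`IsMereotopology`, `isRegionStructure_concrete`). A continuous open
map onto the real line pulls intervals back to the sequences of a domino ready structure
(`dominoReady_concrete`); in `ℝⁿ` this map is a coordinate, and the regions are unbounded slabs. A
class with a domino ready member passes to its substructures, as the member is isomorphic to its
substructure with full domain.
-/

namespace RegionLogic

/-! ### Derived connectives -/

namespace Formula

/-- Implication. -/
def imp (φ ψ : Formula) : Formula := neg (and φ (neg ψ))

/-- The diamond dual to `[r]`. -/
def dia (r : RCC8) (φ : Formula) : Formula := neg (box r (neg φ))

/-- Finite conjunctions, the empty one being a tautology. -/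
def conj : List Formula → Formula
  | [] => neg (and (var 0) (neg (var 0)))
  | φ :: l => and φ (conj l)

/-- The universal modality: the conjunction of all eight boxes. -/
def boxAll (φ : Formula) : Formula :=
  conj ([.dc, .ec, .po, .eq, .tpp, .ntpp, .tppi, .ntppi].map fun r => box r φ)

/-- The box for the relation that leads from `s` by `tpp` to a region marked `k`, and from there by
`tpp` to a region marked `0`. -/
def boxLink (k : ℕ) (φ : Formula) : Formula :=
  box .tpp (imp (var k) (box .tpp (imp (var 0) φ)))

end Formula

section Models

open Formula

variable {R : RelStructure.{u}} {V : ℕ → Set R.carrier} {s : R.carrier} {φ ψ : Formula}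

@[simp] theorem sat_var {i : ℕ} : Sat R V s (var i) ↔ s ∈ V i := Iff.rfl

@[simp] theorem sat_neg : Sat R V s (neg φ) ↔ ¬ Sat R V s φ := Iff.rfl

@[simp] theorem sat_and : Sat R V s (and φ ψ) ↔ Sat R V s φ ∧ Sat R V s ψ := Iff.rfl

@[simp] theorem sat_box {r : RCC8} :
    Sat R V s (box r φ) ↔ ∀ t, R.rel r s t → Sat R V t φ := Iff.rfl

@[simp] theorem sat_imp : Sat R V s (imp φ ψ) ↔ (Sat R V s φ → Sat R V s ψ) := by
  simp [imp]

@[simp] theorem sat_dia {r : RCC8} :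
    Sat R V s (dia r φ) ↔ ∃ t, R.rel r s t ∧ Sat R V t φ := by
  simp [dia]

@[simp] theorem sat_conj {l : List Formula} :
    Sat R V s (conj l) ↔ ∀ φ ∈ l, Sat R V s φ := by
  induction l with
  | nil => simp [conj]
  | cons φ l ih => simp [conj, ih]

theorem sat_boxAll (hR : IsRegionStructure R) :
    Sat R V s (boxAll φ) ↔ ∀ t, Sat R V t φ := by
  constructor
  · intro h t
    obtain ⟨r, hr⟩ := hR.exhaustive s t
    simp only [boxAll, sat_conj, List.mem_map] at h
    exact h (box r φ) ⟨r, by cases r <;> simp, rfl⟩ t hr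
  · intro h
    simp only [boxAll, sat_conj, List.mem_map]
    rintro _ ⟨r, -, rfl⟩ t -
    exact h t

/-- The relation of two `tpp` steps, through a region marked `k` to a region marked `0`. -/
def Link (V : ℕ → Set R.carrier) (k : ℕ) (s t : R.carrier) : Prop :=
  ∃ m, R.rel .tpp s m ∧ m ∈ V k ∧ R.rel .tpp m t ∧ t ∈ V 0

@[simp] theorem sat_boxLink {k : ℕ} :
    Sat R V s (boxLink k φ) ↔ ∀ t, Link V k s t → Sat R V t φ := by
  simp only [boxLink, sat_box, sat_imp, sat_var, Link]
  exact ⟨fun h t ⟨m, h1, h2, h3, h4⟩ => h m h1 h2 t h3 h4,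
    fun h m h1 h2 t h3 h4 => h t ⟨m, h1, h2, h3, h4⟩⟩

/-! ### Tile systems and the formulas that describe tilings -/

/-- A finite set of tiles with a relation between horizontal and one between vertical
neighbours. -/
structure TileSystem where
  /-- the tiles -/
  Tile : Type
  [fintype : Fintype Tile]
  /-- `hor t t'`: the tile `t'` may stand to the right of `t` -/
  hor : Tile → Tile → Prop
  /-- `ver t t'`: the tile `t'` may stand above `t` -/
  ver : Tile → Tile → Prop

attribute [instance] TileSystem.fintype

/-- The first quadrant has a tiling whose bottom row starts with the word `w`. -/
def TileSystem.Tiles (D : TileSystem) (w : List D.Tile) : Prop :=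
  ∃ τ : ℕ → ℕ → D.Tile,
    (∀ a b, D.hor (τ a b) (τ (a + 1) b)) ∧ (∀ a b, D.ver (τ a b) (τ a (b + 1))) ∧
    ∀ i t, w[i]? = some t → τ i 0 = t

/-- The variable that marks the regions carrying the tile `t`. The variables `0`, …, `3` are in use
for cells, intermediate regions and wall cells. -/
noncomputable def TileSystem.tileVar (D : TileSystem) (t : D.Tile) : ℕ :=
  4 + (Fintype.equivFin D.Tile t : ℕ)

theorem TileSystem.tileVar_injective (D : TileSystem) : Function.Injective D.tileVar := by
  intro t t' h
  simp only [tileVar, Nat.add_left_cancel_iff, Fin.val_inj] at h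
  exact (Fintype.equivFin D.Tile).injective h

/-- A model carrying a tiling by `D`. The regions marked `0` are the cells; every cell has a
successor among the cells, by a link through the mark `1`, and a right neighbour, by a link through
the mark `2`. The mark `3` singles out the wall cells, which are not right neighbours. -/
structure TilingModel (D : TileSystem) (R : RelStructure.{u}) (V : ℕ → Set R.carrier) : Prop where
  cell_dc : ∀ s ∈ V 0, ∀ t, R.rel .dc s t → t ∉ V 0 ∧ t ∉ V 1
  cell_ec : ∀ s ∈ V 0, ∀ t, R.rel .ec s t → t ∉ V 0 ∧ t ∉ V 1
  cell_po : ∀ s ∈ V 0, ∀ t, R.rel .po s t → t ∉ V 0 ∧ t ∉ V 1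
  cell_tpp : ∀ s ∈ V 0, ∀ t, R.rel .tpp s t → t ∉ V 0
  link_dc : ∀ s ∈ V 2, ∀ t, R.rel .dc s t → t ∉ V 2
  link_ec : ∀ s ∈ V 2, ∀ t, R.rel .ec s t → t ∉ V 2
  link_po : ∀ s ∈ V 2, ∀ t, R.rel .po s t → t ∉ V 2
  link_tpp : ∀ s ∈ V 2, ∀ t, R.rel .tpp s t → t ∉ V 2
  exists_succ : ∀ s ∈ V 0, ∃ t, Link V 1 s t
  exists_right : ∀ s ∈ V 0, ∃ t, Link V 2 s t
  right_not_wall : ∀ s ∈ V 0, ∀ t, Link V 2 s t → t ∉ V 3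
  exists_left : ∀ s ∈ V 0, s ∉ V 3 → ∃ m, R.rel .tppi s m ∧ m ∈ V 2 ∧ ∃ t, R.rel .tppi m t ∧ t ∈ V 0
  up_not_wall : ∀ s ∈ V 0, s ∉ V 3 → ∀ t, Link V 2 s t → ∀ t', Link V 1 t t' → t' ∉ V 3
  exists_tile : ∀ s ∈ V 0, ∃ t, s ∈ V (D.tileVar t)
  tile_hor : ∀ i j, ¬ D.hor i j → ∀ s ∈ V 0, s ∈ V (D.tileVar i) →
    ∀ t, Link V 2 s t → t ∉ V (D.tileVar j)
  tile_ver : ∀ i j, ¬ D.ver i j → ∀ s ∈ V 0, s ∈ V (D.tileVar i) →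
    ∀ t, Link V 2 s t → ∀ t', Link V 1 t t' → t' ∉ V (D.tileVar j)

open Classical in
/-- The formula that expresses `TilingModel`, when true at all regions. -/
noncomputable def TileSystem.localFormula (D : TileSystem) : Formula :=
  conj
    ([imp (var 0) (box .dc (and (neg (var 0)) (neg (var 1)))),
      imp (var 0) (box .ec (and (neg (var 0)) (neg (var 1)))),
      imp (var 0) (box .po (and (neg (var 0)) (neg (var 1)))),
      imp (var 0) (box .tpp (neg (var 0))),
      imp (var 2) (box .dc (neg (var 2))),
      imp (var 2) (box .ec (neg (var 2))),
      imp (var 2) (box .po (neg (var 2))),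
      imp (var 2) (box .tpp (neg (var 2))),
      imp (var 0) (dia .tpp (and (var 1) (dia .tpp (var 0)))),
      imp (var 0) (dia .tpp (and (var 2) (dia .tpp (var 0)))),
      imp (var 0) (boxLink 2 (neg (var 3))),
      imp (var 0) (imp (neg (var 3)) (dia .tppi (and (var 2) (dia .tppi (var 0))))),
      imp (var 0) (imp (neg (var 3)) (boxLink 2 (boxLink 1 (neg (var 3))))),
      imp (var 0) (neg (conj (Finset.univ.toList.map fun t => neg (var (D.tileVar t)))))] ++
    ((Finset.univ.filter fun p : D.Tile × D.Tile => ¬ D.hor p.1 p.2).toList.map fun p =>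
      imp (var 0) (imp (var (D.tileVar p.1)) (boxLink 2 (neg (var (D.tileVar p.2)))))) ++
    ((Finset.univ.filter fun p : D.Tile × D.Tile => ¬ D.ver p.1 p.2).toList.map fun p =>
      imp (var 0) (imp (var (D.tileVar p.1)) (boxLink 2 (boxLink 1 (neg (var (D.tileVar p.2))))))))

theorem forall_sat_localFormula (D : TileSystem) :
    (∀ s, Sat R V s D.localFormula) ↔ TilingModel D R V := by
  have key : ∀ k s, (∃ t, R.rel .tpp s t ∧ t ∈ V k ∧ ∃ t', R.rel .tpp t t' ∧ t' ∈ V 0) ↔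
      ∃ t, Link V k s t := by
    intro k s
    constructor
    · rintro ⟨m, h1, h2, t, h3⟩; exact ⟨t, m, h1, h2, h3⟩
    · rintro ⟨t, m, h1, h2, h3⟩; exact ⟨m, h1, h2, t, h3⟩
  simp only [TileSystem.localFormula, sat_conj, List.forall_mem_append, List.forall_mem_cons,
    List.forall_mem_map, sat_imp, sat_var, sat_box, sat_and, sat_neg, sat_dia, sat_boxLink, key,
    Finset.mem_toList, Finset.mem_filter, Finset.mem_univ, true_and, Prod.forall, forall_and,
    List.not_mem_nil, false_imp_iff, implies_true, and_true, not_forall, not_not, forall_const]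
  constructor
  · rintro ⟨⟨⟨h1, h2, h3, h4, h5, h6, h7, h8, h9, h10, h11, h12, h13, h14⟩, h15⟩, h16⟩
    exact ⟨fun s hs t h => ⟨h1.1 s hs t h, h1.2 s hs t h⟩,
      fun s hs t h => ⟨h2.1 s hs t h, h2.2 s hs t h⟩,
      fun s hs t h => ⟨h3.1 s hs t h, h3.2 s hs t h⟩, h4, h5, h6, h7, h8, h9, h10, h11, h12, h13,
      h14, fun i j h s => h15 s i j h, fun i j h s => h16 s i j h⟩
  · rintro ⟨h1, h2, h3, h4, h5, h6, h7, h8, h9, h10, h11, h12, h13, h14, h15, h16⟩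
    exact ⟨⟨⟨⟨fun s hs t h => (h1 s hs t h).1, fun s hs t h => (h1 s hs t h).2⟩,
      ⟨fun s hs t h => (h2 s hs t h).1, fun s hs t h => (h2 s hs t h).2⟩,
      ⟨fun s hs t h => (h3 s hs t h).1, fun s hs t h => (h3 s hs t h).2⟩, h4, h5, h6, h7, h8, h9,
      h10, h11, h12, h13, h14⟩, fun s i j h => h15 i j h s⟩, fun s i j h => h16 i j h s⟩

open Classical in
/-- The formula stating that a cell and its iterated right neighbours carry the tiles of the word
`w`, and no others. -/
noncomputable def TileSystem.wordFormula (D : TileSystem) : List D.Tile → Formula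
  | [] => conj []
  | t :: w => and
      (conj ((Finset.univ.filter fun t' => t' ≠ t).toList.map fun t' => neg (var (D.tileVar t'))))
      (boxLink 2 (D.wordFormula w))

@[simp] theorem sat_wordFormula_nil {D : TileSystem} : Sat R V s (D.wordFormula []) := by
  simp [TileSystem.wordFormula]

@[simp] theorem sat_wordFormula_cons {D : TileSystem} {t : D.Tile} {w : List D.Tile} :
    Sat R V s (D.wordFormula (t :: w)) ↔ (∀ t', s ∈ V (D.tileVar t') → t' = t) ∧
      ∀ s', Link V 2 s s' → Sat R V s' (D.wordFormula w) := by
  simp only [TileSystem.wordFormula, sat_and, sat_conj, List.forall_mem_map, Finset.mem_toList,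
    Finset.mem_filter, Finset.mem_univ, true_and, sat_neg, sat_var, sat_boxLink]
  exact and_congr_left fun _ => forall_congr' fun t' => not_imp_not

/-- The formula that is satisfiable if and only if the quadrant has a tiling whose bottom row
starts with the word `w`. -/
noncomputable def TileSystem.formula (D : TileSystem) (w : List D.Tile) : Formula :=
  and (and (var 0) (boxAll D.localFormula)) (D.wordFormula w)

theorem sat_formula {D : TileSystem} {w : List D.Tile} (hR : IsRegionStructure R) :
    Sat R V s (D.formula w) ↔ (s ∈ V 0 ∧ TilingModel D R V) ∧ Sat R V s (D.wordFormula w) := by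
  simp only [TileSystem.formula, sat_and, sat_var, sat_boxAll hR, forall_sat_localFormula]

/-! ### Proper parts in region structures -/

/-- Proper parthood: `tpp` or `ntpp`. -/
def RelStructure.ProperPart (R : RelStructure.{u}) (s t : R.carrier) : Prop :=
  R.rel .tpp s t ∨ R.rel .ntpp s t

namespace IsRegionStructure

variable {a b c : R.carrier} (hR : IsRegionStructure R)
include hR

theorem not_tpp_of_ntpp (h : R.rel .ntpp a b) : ¬ R.rel .tpp a b := fun h' => by
  cases hR.disjoint _ _ _ _ h h'

theorem ntpp_of_tpp_of_ntpp (h : R.rel .tpp a b) (h' : R.rel .ntpp b c) : R.rel .ntpp a c := by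
  simpa [compTable] using hR.comp _ _ _ _ _ h h'

theorem ntpp_of_ntpp_of_tpp (h : R.rel .ntpp a b) (h' : R.rel .tpp b c) : R.rel .ntpp a c := by
  simpa [compTable] using hR.comp _ _ _ _ _ h h'

theorem ntpp_trans (h : R.rel .ntpp a b) (h' : R.rel .ntpp b c) : R.rel .ntpp a c := by
  simpa [compTable] using hR.comp _ _ _ _ _ h h'

theorem ntpp_of_ntpp_of_properPart (h : R.rel .ntpp a b) (h' : R.ProperPart b c) :
    R.rel .ntpp a c :=
  h'.elim (hR.ntpp_of_ntpp_of_tpp h) (hR.ntpp_trans h)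

theorem ntpp_of_properPart_of_ntpp (h : R.ProperPart a b) (h' : R.rel .ntpp b c) :
    R.rel .ntpp a c :=
  h.elim (fun h => hR.ntpp_of_tpp_of_ntpp h h') fun h => hR.ntpp_trans h h'

theorem properPart_trans (h : R.ProperPart a b) (h' : R.ProperPart b c) : R.ProperPart a c := by
  rcases h with h | h
  · rcases h' with h' | h'
    · simpa [compTable, RelStructure.ProperPart] using hR.comp _ _ _ _ _ h h'
    · exact Or.inr (hR.ntpp_of_tpp_of_ntpp h h')
  · exact Or.inr (hR.ntpp_of_ntpp_of_properPart h h')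

theorem not_properPart_self : ¬ R.ProperPart a a := by
  have h := (hR.eq_iff a a).2 rfl
  rintro (h' | h') <;> cases hR.disjoint _ _ _ _ h h'

theorem comparable (h1 : ¬ R.rel .dc a b) (h2 : ¬ R.rel .ec a b) (h3 : ¬ R.rel .po a b) :
    R.ProperPart a b ∨ a = b ∨ R.ProperPart b a := by
  obtain ⟨r, hr⟩ := hR.exhaustive a b
  cases r with
  | dc => exact absurd hr h1
  | ec => exact absurd hr h2
  | po => exact absurd hr h3
  | eq => exact Or.inr (Or.inl ((hR.eq_iff _ _).1 hr))
  | tpp => exact Or.inl (Or.inl hr)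
  | ntpp => exact Or.inl (Or.inr hr)
  | tppi => exact Or.inr (Or.inr (Or.inl ((hR.tppi_iff _ _).1 hr)))
  | ntppi => exact Or.inr (Or.inr (Or.inr ((hR.ntppi_iff _ _).1 hr)))

end IsRegionStructure

/-! ### From models to tilings -/

namespace TilingModel

variable {D : TileSystem} {a b c d : R.carrier} (hR : IsRegionStructure R) (hV : TilingModel D R V)
include hR hV

theorem cell_cases (ha : a ∈ V 0) (hb : b ∈ V 0) :
    R.rel .ntpp a b ∨ a = b ∨ R.rel .ntpp b a := by
  rcases hR.comparable (fun h => (hV.cell_dc a ha b h).1 hb) (fun h => (hV.cell_ec a ha b h).1 hb)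
    (fun h => (hV.cell_po a ha b h).1 hb) with (h | h) | h | (h | h)
  · exact absurd hb (hV.cell_tpp a ha b h)
  · exact Or.inl h
  · exact Or.inr (Or.inl h)
  · exact absurd ha (hV.cell_tpp b hb a h)
  · exact Or.inr (Or.inr h)

theorem link_cases (ha : a ∈ V 2) (hb : b ∈ V 2) :
    R.rel .ntpp a b ∨ a = b ∨ R.rel .ntpp b a := by
  rcases hR.comparable (fun h => hV.link_dc a ha b h hb) (fun h => hV.link_ec a ha b h hb)
    (fun h => hV.link_po a ha b h hb) with (h | h) | h | (h | h)
  · exact absurd hb (hV.link_tpp a ha b h)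
  · exact Or.inl h
  · exact Or.inr (Or.inl h)
  · exact absurd ha (hV.link_tpp b hb a h)
  · exact Or.inr (Or.inr h)

/-- A link through the mark `1` leads to the least cell above the given one. -/
theorem succ_le (hb : b ∈ V 0) (hab : R.rel .ntpp a b) (hac : Link V 1 a c) :
    c = b ∨ R.rel .ntpp c b := by
  obtain ⟨m, ham, hm, hmc, hc⟩ := hac
  rcases hV.cell_cases hR hb hc with h | h | h
  · exfalso
    rcases hR.comparable (fun h => (hV.cell_dc b hb m h).2 hm)
      (fun h => (hV.cell_ec b hb m h).2 hm) (fun h => (hV.cell_po b hb m h).2 hm) with h' | rfl | h'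
    · exact hR.not_tpp_of_ntpp (hR.ntpp_of_ntpp_of_properPart hab h') ham
    · exact hR.not_tpp_of_ntpp hab ham
    · exact hR.not_tpp_of_ntpp (hR.ntpp_of_properPart_of_ntpp h' h) hmc
  · exact Or.inl h.symm
  · exact Or.inr h

theorem lt_of_link {k : ℕ} (ha : a ∈ V 0) (h : Link V k a b) : R.rel .ntpp a b := by
  obtain ⟨m, ham, -, hmb, hb⟩ := h
  rcases hR.properPart_trans (Or.inl ham) (Or.inl hmb) with h | h
  · exact absurd hb (hV.cell_tpp a ha b h)
  · exact h

/-- Links through the mark `2` are strictly monotone on the cells. -/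
theorem right_lt (hab : R.rel .ntpp a b) (hac : Link V 2 a c)
    (hbd : Link V 2 b d) : R.rel .ntpp c d := by
  obtain ⟨m, ham, hm, hmc, hc⟩ := hac
  obtain ⟨n, hbn, hn, hnd, hd⟩ := hbd
  have hmn : R.rel .ntpp m n := by
    rcases hV.link_cases hR hm hn with h | rfl | h
    · exact h
    · exact absurd ham (hR.not_tpp_of_ntpp (hR.ntpp_of_ntpp_of_tpp hab hbn))
    · exact absurd ham (hR.not_tpp_of_ntpp (hR.ntpp_trans (hR.ntpp_of_ntpp_of_tpp hab hbn) h))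
  have hmd := hR.ntpp_of_ntpp_of_tpp hmn hnd
  rcases hV.cell_cases hR hc hd with h | rfl | h
  · exact h
  · exact absurd hmc (hR.not_tpp_of_ntpp hmd)
  · exact absurd hmc (hR.not_tpp_of_ntpp (hR.ntpp_trans hmd h))

theorem right_unique (hac : Link V 2 a c) (had : Link V 2 a d) : c = d := by
  obtain ⟨m, ham, hm, hmc, hc⟩ := hac
  obtain ⟨n, han, hn, hnd, hd⟩ := had
  have hmn : m = n := by
    rcases hV.link_cases hR hm hn with h | h | h
    · exact absurd han (hR.not_tpp_of_ntpp (hR.ntpp_of_tpp_of_ntpp ham h))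
    · exact h
    · exact absurd ham (hR.not_tpp_of_ntpp (hR.ntpp_of_tpp_of_ntpp han h))
  subst hmn
  rcases hV.cell_cases hR hc hd with h | h | h
  · exact absurd hnd (hR.not_tpp_of_ntpp (hR.ntpp_of_tpp_of_ntpp hmc h))
  · exact h
  · exact absurd hmc (hR.not_tpp_of_ntpp (hR.ntpp_of_tpp_of_ntpp hnd h))

/-- The right neighbour of the successor of a cell `a` that is not a wall cell is the successor of
its right neighbour: the latter successor is no wall cell, hence the right neighbour of some cell
`e`, which lies above `a` by monotonicity, and so not below the successor of `a`. -/
theorem right_succ_comm {b' c' : R.carrier} (ha : a ∈ V 0) (hw : a ∉ V 3) (hab : Link V 1 a b)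
    (hbb : Link V 2 b b') (hac : Link V 2 a c) (hcc : Link V 1 c c') : b' = c' := by
  have hb : b ∈ V 0 := by obtain ⟨_, _, _, _, h⟩ := hab; exact h
  have hc : c ∈ V 0 := by obtain ⟨_, _, _, _, h⟩ := hac; exact h
  have hb' : b' ∈ V 0 := by obtain ⟨_, _, _, _, h⟩ := hbb; exact h
  have hc' : c' ∈ V 0 := by obtain ⟨_, _, _, _, h⟩ := hcc; exact h
  have hwc := hV.up_not_wall a ha hw c hac c' hcc
  obtain ⟨m, hcm, hm, e, hme, he⟩ := hV.exists_left c' hc' hwc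
  have hec : Link V 2 e c' := ⟨m, (hR.tppi_iff _ _).1 hme, hm, (hR.tppi_iff _ _).1 hcm, hc'⟩
  have hlt := hV.lt_of_link hR hc hcc
  have hae : R.rel .ntpp a e := by
    rcases hV.cell_cases hR ha he with h | rfl | h
    · exact h
    · obtain rfl := hV.right_unique hR hac hec
      exact absurd (Or.inr hlt) hR.not_properPart_self
    · exact absurd (Or.inr (hR.ntpp_trans (hV.right_lt hR h hec hac) hlt))
        hR.not_properPart_self
  have h1 : b' = c' ∨ R.rel .ntpp b' c' := by
    rcases hV.succ_le hR he hae hab with rfl | h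
    · exact Or.inl (hV.right_unique hR hbb hec)
    · exact Or.inr (hV.right_lt hR h hbb hec)
  rcases h1 with h1 | h1
  · exact h1
  rcases hV.succ_le hR hb' (hV.right_lt hR (hV.lt_of_link hR ha hab) hac hbb) hcc with h | h
  · exact h.symm
  · exact absurd (Or.inr (hR.ntpp_trans h h1)) hR.not_properPart_self

/-- A model of the local formula yields a tiling: the cell at `(a, b)` is reached from the cell at
the origin by `a` steps to the right and `b` steps up, where a step up consists of a step to the
right and one to the successor. -/
theorem tiles {w : List D.Tile} (hs : s ∈ V 0) (hw : Sat R V s (D.wordFormula w)) :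
    D.Tiles w := by
  have memV : ∀ {k : ℕ} {x y : R.carrier}, Link V k x y → y ∈ V 0 := by
    rintro k x y ⟨_, _, _, _, h⟩; exact h
  choose! S hS using hV.exists_succ
  choose! F hF using hV.exists_right
  have : Nonempty D.Tile := (hV.exists_tile s hs).nonempty
  choose! T hT using hV.exists_tile
  have hS0 : ∀ x ∈ V 0, S x ∈ V 0 := fun x hx => memV (hS x hx)
  have hF0 : ∀ x ∈ V 0, F x ∈ V 0 := fun x hx => memV (hF x hx)
  have comm : ∀ x ∈ V 0, F (S (F x)) = S (F (F x)) := fun x hx =>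
    hV.right_succ_comm hR (hF0 x hx) (hV.right_not_wall x hx _ (hF x hx))
      (hS _ (hF0 x hx)) (hF _ (hS0 _ (hF0 x hx))) (hF _ (hF0 x hx)) (hS _ (hF0 _ (hF0 x hx)))
  let pos : ℕ → ℕ → R.carrier := fun a b => (fun x => S (F x))^[b] (F^[a] s)
  have pos_zero : ∀ a, pos a 0 = F^[a] s := fun a => rfl
  have pos_up : ∀ a b, pos a (b + 1) = S (F (pos a b)) := fun a b =>
    Function.iterate_succ_apply' _ _ _
  have hpos0 : ∀ a, pos a 0 ∈ V 0 := by
    intro a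
    rw [pos_zero]
    induction a with
    | zero => exact hs
    | succ a ih => rw [Function.iterate_succ_apply']; exact hF0 _ ih
  have hpos : ∀ a b, pos a b ∈ V 0 := by
    intro a b
    induction b with
    | zero => exact hpos0 a
    | succ b ih => rw [pos_up]; exact hS0 _ (hF0 _ ih)
  have pos_right : ∀ a b, pos (a + 1) b = F (pos a b) := by
    intro a b
    induction b with
    | zero => rw [pos_zero, pos_zero, Function.iterate_succ_apply']
    | succ b ih => rw [pos_up, pos_up, ih, comm _ (hpos a b)]
  refine ⟨fun a b => T (pos a b), fun a b => ?_, fun a b => ?_, ?_⟩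
  · by_contra h
    refine hV.tile_hor _ _ h _ (hpos a b) (hT _ (hpos a b)) _ (hF _ (hpos a b)) ?_
    rw [← pos_right]
    exact hT _ (hpos _ _)
  · by_contra h
    refine hV.tile_ver _ _ h _ (hpos a b) (hT _ (hpos a b)) _ (hF _ (hpos a b)) _
      (hS _ (hF0 _ (hpos a b))) ?_
    rw [← pos_up]
    exact hT _ (hpos _ _)
  · have word : ∀ (w : List D.Tile) (x : R.carrier), x ∈ V 0 → Sat R V x (D.wordFormula w) →
        ∀ i t, w[i]? = some t → T (F^[i] x) = t := by
      intro w
      induction w with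
      | nil => simp
      | cons t₀ w ih =>
        intro x hx h i t hi
        rw [sat_wordFormula_cons] at h
        cases i with
        | zero =>
          obtain rfl : t₀ = t := by simpa using hi
          exact h.1 _ (hT x hx)
        | succ i => exact ih (F x) (hF0 x hx) (h.2 _ (hF x hx)) i t (by simpa using hi)
    exact word w s hs hw

end TilingModel

end Models

/-! ### The diagonal enumeration -/

/-- The number of a position of the quadrant in the enumeration `tilePos`. -/
def tileIdx (p : ℕ × ℕ) : ℕ := ∑ k ∈ Finset.range (p.1 + p.2 + 1), k + p.2 + 1

theorem tileIdx_pos (p : ℕ × ℕ) : 1 ≤ tileIdx p := Nat.le_add_left _ _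

theorem tileIdx_diag (a b : ℕ) : tileIdx (a, b + 1) = tileIdx (a + 1, b) + 1 := by
  simp only [tileIdx, show a + (b + 1) + 1 = a + 1 + b + 1 by ring]
  ring

theorem tileIdx_floor (b : ℕ) : tileIdx (b + 1, 0) = tileIdx (0, b) + 1 := by
  simp only [tileIdx, zero_add, add_zero, Finset.sum_range_succ _ (b + 1)]
  ring

theorem tileIdx_right (a b : ℕ) : tileIdx (a + 1, b) = tileIdx (a, b) + (a + b + 1) := by
  simp only [tileIdx, show a + 1 + b + 1 = a + b + 1 + 1 by ring,
    Finset.sum_range_succ _ (a + b + 1)]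
  ring

theorem tilePos_succ_of_zero {n b : ℕ} (hn : 1 ≤ n) (h : tilePos n = (0, b)) :
    tilePos (n + 1) = (b + 1, 0) := by
  obtain ⟨n, rfl⟩ := Nat.exists_eq_add_of_le' hn
  rw [tilePos, h]

theorem tilePos_succ_of_succ {n a b : ℕ} (hn : 1 ≤ n) (h : tilePos n = (a + 1, b)) :
    tilePos (n + 1) = (a, b + 1) := by
  obtain ⟨n, rfl⟩ := Nat.exists_eq_add_of_le' hn
  rw [tilePos, h]

theorem tileIdx_tilePos {n : ℕ} (hn : 1 ≤ n) : tileIdx (tilePos n) = n := by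
  induction n, hn using Nat.le_induction with
  | base => rfl
  | succ n hn ih =>
    rcases h : tilePos n with ⟨_ | a, b⟩
    · rw [tilePos_succ_of_zero hn h, tileIdx_floor, ← h, ih]
    · rw [tilePos_succ_of_succ hn h, tileIdx_diag, ← h, ih]

theorem tilePos_tileIdx (p : ℕ × ℕ) : tilePos (tileIdx p) = p := by
  induction h : tileIdx p using Nat.strong_induction_on generalizing p with
  | _ n ih =>
    subst h
    rcases p with ⟨_ | a, _ | b⟩
    · rfl
    · have := ih _ (by rw [tileIdx_diag]; omega) (0 + 1, b) rfl
      rw [tileIdx_diag, tilePos_succ_of_succ (tileIdx_pos _) this]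
    · have := ih _ (by rw [tileIdx_floor]; omega) (0, a) rfl
      rw [tileIdx_floor, tilePos_succ_of_zero (tileIdx_pos _) this]
    · have := ih _ (by rw [tileIdx_diag]; omega) (a + 1 + 1, b) rfl
      rw [tileIdx_diag, tilePos_succ_of_succ (tileIdx_pos _) this]

/-! ### From tilings to models on domino ready structures -/

/-- Two sequences that witness that `R` is domino ready. -/
structure DominoSequences (R : RelStructure.{u}) (x y : ℕ → R.carrier) : Prop where
  tpp_succ : ∀ {i}, 1 ≤ i → R.rel .tpp (x i) (x (i + 1))
  ntpp_of_lt : ∀ {i j}, 1 ≤ i → i + 1 < j → R.rel .ntpp (x i) (x j)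
  tpp_y : ∀ {i}, 1 ≤ i → R.rel .tpp (x (2 * i - 1)) (y i)
  y_tpp : ∀ {i j}, 1 ≤ i → 1 ≤ j →
    (R.rel .tpp (y i) (x (2 * j - 1)) ↔ tilePos j = ((tilePos i).1 + 1, (tilePos i).2))
  y_ntpp : ∀ {i j}, 1 ≤ i → i < j → R.rel .ntpp (y i) (y j)

theorem DominoReady.exists_sequences {R : RelStructure.{u}} (h : DominoReady R) :
    ∃ x y, DominoSequences R x y := by
  obtain ⟨x, y, h⟩ := h
  exact ⟨x, y, fun hi => (h _ 1 hi le_rfl).1, fun {i j} hi hj => (h i j hi (by omega)).2.1 hj,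
    fun hi => (h _ 1 hi le_rfl).2.2.1, fun hi hj => (h _ _ hi hj).2.2.2.1,
    fun {i j} hi hj => (h i j hi (by omega)).2.2.2.2 hj⟩

/-- The valuation that describes the tiling `τ`: the cells are the regions `x (2 * i - 1)`, which
carry the tile at the `i`-th position of the quadrant. -/
noncomputable def tilingValuation (D : TileSystem) {R : RelStructure.{u}} (x y : ℕ → R.carrier)
    (τ : ℕ → ℕ → D.Tile) : ℕ → Set R.carrier
  | 0 => {s | ∃ i, 1 ≤ i ∧ s = x (2 * i - 1)}
  | 1 => {s | ∃ i, 1 ≤ i ∧ s = x (2 * i)}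
  | 2 => {s | ∃ i, 1 ≤ i ∧ s = y i}
  | 3 => {s | ∃ i, 1 ≤ i ∧ s = x (2 * i - 1) ∧ (tilePos i).1 = 0}
  | n + 4 => {s | ∃ i, 1 ≤ i ∧ s = x (2 * i - 1) ∧
      D.tileVar (τ (tilePos i).1 (tilePos i).2) = n + 4}

namespace DominoSequences

variable {R : RelStructure.{u}} {x y : ℕ → R.carrier} {i j : ℕ} {D : TileSystem}
  {τ : ℕ → ℕ → D.Tile} (hR : IsRegionStructure R) (h : DominoSequences R x y)

include h in
theorem properPart (hi : 1 ≤ i) (hij : i < j) : R.ProperPart (x i) (x j) := by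
  rcases (show i + 1 ≤ j from hij).eq_or_lt with rfl | hj
  · exact Or.inl (h.tpp_succ hi)
  · exact Or.inr (h.ntpp_of_lt hi hj)

include hR h

theorem rel_x (hi : 1 ≤ i) (hj : 1 ≤ j) {r : RCC8} (hr : R.rel r (x i) (x j)) :
    r ≠ .dc ∧ r ≠ .ec ∧ r ≠ .po := by
  rcases lt_trichotomy i j with hij | rfl | hij
  · rcases h.properPart hi hij with h' | h' <;> rw [hR.disjoint _ _ _ _ hr h'] <;> simp
  · rw [hR.disjoint _ _ _ _ hr ((hR.eq_iff _ _).2 rfl)]; simp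
  · rcases h.properPart hj hij with h' | h'
    · rw [hR.disjoint _ _ _ _ hr ((hR.tppi_iff _ _).2 h')]; simp
    · rw [hR.disjoint _ _ _ _ hr ((hR.ntppi_iff _ _).2 h')]; simp

theorem rel_y (hi : 1 ≤ i) (hj : 1 ≤ j) {r : RCC8} (hr : R.rel r (y i) (y j)) :
    r ≠ .dc ∧ r ≠ .ec ∧ r ≠ .po ∧ r ≠ .tpp := by
  rcases lt_trichotomy i j with hij | rfl | hij
  · rw [hR.disjoint _ _ _ _ hr (h.y_ntpp hi hij)]; simp
  · rw [hR.disjoint _ _ _ _ hr ((hR.eq_iff _ _).2 rfl)]; simp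
  · rw [hR.disjoint _ _ _ _ hr ((hR.ntppi_iff _ _).2 (h.y_ntpp hj hij))]; simp

theorem eq_succ_of_tpp (hi : 1 ≤ i) (hj : 1 ≤ j) (hr : R.rel .tpp (x i) (x j)) : j = i + 1 := by
  rcases lt_trichotomy i j with hij | rfl | hij
  · rcases (show i + 1 ≤ j from hij).eq_or_lt with rfl | hj
    · rfl
    · exact absurd hr (hR.not_tpp_of_ntpp (h.ntpp_of_lt hi hj))
  · exact absurd (Or.inl hr) hR.not_properPart_self
  · exact absurd (hR.properPart_trans (Or.inl hr) (h.properPart hj hij)) hR.not_properPart_self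

theorem x_injective (hi : 1 ≤ i) (hj : 1 ≤ j) (hij : x i = x j) : i = j := by
  rcases lt_trichotomy i j with h' | h' | h'
  · exact absurd (hij ▸ h.properPart hi h') hR.not_properPart_self
  · exact h'
  · exact absurd (hij ▸ h.properPart hj h') hR.not_properPart_self

theorem eq_of_tpp_y (hi : 1 ≤ i) (hj : 1 ≤ j) (hr : R.rel .tpp (x (2 * i - 1)) (y j)) :
    j = i := by
  rcases lt_trichotomy i j with hij | rfl | hij
  · exact absurd hr (hR.not_tpp_of_ntpp (hR.ntpp_of_tpp_of_ntpp (h.tpp_y hi) (h.y_ntpp hi hij)))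
  · rfl
  · exact absurd (h.tpp_y hi) (hR.not_tpp_of_ntpp (hR.ntpp_of_tpp_of_ntpp hr (h.y_ntpp hj hij)))

theorem link_succ {t : R.carrier} (hi : 1 ≤ i) :
    Link (tilingValuation D x y τ) 1 (x (2 * i - 1)) t ↔ t = x (2 * (i + 1) - 1) := by
  constructor
  · rintro ⟨_, h1, ⟨j, hj, rfl⟩, h2, ⟨k, hk, rfl⟩⟩
    have e1 := h.eq_succ_of_tpp hR (by omega) (by omega) h1
    have e2 := h.eq_succ_of_tpp hR (by omega) (by omega) h2
    congr 1
    omega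
  · rintro rfl
    refine ⟨x (2 * i), ?_, ⟨i, hi, rfl⟩, h.tpp_succ (by omega), ⟨i + 1, by omega, rfl⟩⟩
    have := h.tpp_succ (i := 2 * i - 1) (by omega)
    rwa [show 2 * i - 1 + 1 = 2 * i by omega] at this

theorem link_right {t : R.carrier} (hi : 1 ≤ i) :
    Link (tilingValuation D x y τ) 2 (x (2 * i - 1)) t ↔
      t = x (2 * tileIdx ((tilePos i).1 + 1, (tilePos i).2) - 1) := by
  constructor
  · rintro ⟨_, h1, ⟨j, hj, rfl⟩, h2, ⟨k, hk, rfl⟩⟩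
    obtain rfl := h.eq_of_tpp_y hR hi hj h1
    rw [← (h.y_tpp hj hk).1 h2, tileIdx_tilePos hk]
  · rintro rfl
    exact ⟨y i, h.tpp_y hi, ⟨i, hi, rfl⟩,
      (h.y_tpp hi (tileIdx_pos _)).2 (tilePos_tileIdx _), ⟨_, tileIdx_pos _, rfl⟩⟩

theorem mem_wall (hi : 1 ≤ i) :
    x (2 * i - 1) ∈ tilingValuation D x y τ 3 ↔ (tilePos i).1 = 0 := by
  constructor
  · rintro ⟨j, hj, e, h0⟩
    have := h.x_injective hR (by omega) (by omega) e
    rwa [show i = j by omega]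
  · exact fun h0 => ⟨i, hi, rfl, h0⟩

theorem mem_tileVar (hi : 1 ≤ i) (t : D.Tile) :
    x (2 * i - 1) ∈ tilingValuation D x y τ (D.tileVar t) ↔
      τ (tilePos i).1 (tilePos i).2 = t := by
  have e : ∃ n, D.tileVar t = n + 4 := ⟨_, Nat.add_comm _ _⟩
  obtain ⟨n, hn⟩ := e
  rw [hn]
  constructor
  · rintro ⟨j, hj, e, h0⟩
    have := h.x_injective hR (by omega) (by omega) e
    rw [show i = j by omega]
    exact D.tileVar_injective (h0.trans hn.symm)
  · exact fun h0 => ⟨i, hi, rfl, by rw [h0, hn]⟩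

theorem tilingModel (hhor : ∀ a b, D.hor (τ a b) (τ (a + 1) b))
    (hver : ∀ a b, D.ver (τ a b) (τ a (b + 1))) :
    TilingModel D R (tilingValuation D x y τ) := by
  have comparable : ∀ r, (r = .dc ∨ r = .ec ∨ r = .po) → ∀ s ∈ tilingValuation D x y τ 0,
      ∀ t, R.rel r s t → t ∉ tilingValuation D x y τ 0 ∧ t ∉ tilingValuation D x y τ 1 := by
    rintro r hr _ ⟨i, hi, rfl⟩ t ht
    constructor
    · rintro ⟨j, hj, rfl⟩
      have := h.rel_x hR (by omega) (by omega) ht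
      tauto
    · rintro ⟨j, hj, rfl⟩
      have := h.rel_x hR (by omega) (by omega) ht
      tauto
  have right_up : ∀ i, 1 ≤ i →
      tilePos (tileIdx ((tilePos i).1 + 1, (tilePos i).2) + 1) =
        ((tilePos i).1, (tilePos i).2 + 1) := fun i hi =>
    tilePos_succ_of_succ (tileIdx_pos _) (tilePos_tileIdx _)
  constructor
  · exact comparable _ (by simp)
  · exact comparable _ (by simp)
  · exact comparable _ (by simp)
  · rintro _ ⟨i, hi, rfl⟩ _ ht ⟨j, hj, rfl⟩
    have := h.eq_succ_of_tpp hR (by omega) (by omega) ht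
    omega
  · rintro _ ⟨i, hi, rfl⟩ _ ht ⟨j, hj, rfl⟩
    exact (h.rel_y hR hi hj ht).1 rfl
  · rintro _ ⟨i, hi, rfl⟩ _ ht ⟨j, hj, rfl⟩
    exact (h.rel_y hR hi hj ht).2.1 rfl
  · rintro _ ⟨i, hi, rfl⟩ _ ht ⟨j, hj, rfl⟩
    exact (h.rel_y hR hi hj ht).2.2.1 rfl
  · rintro _ ⟨i, hi, rfl⟩ _ ht ⟨j, hj, rfl⟩
    exact (h.rel_y hR hi hj ht).2.2.2 rfl
  · rintro _ ⟨i, hi, rfl⟩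
    exact ⟨_, (h.link_succ hR hi).2 rfl⟩
  · rintro _ ⟨i, hi, rfl⟩
    exact ⟨_, (h.link_right hR hi).2 rfl⟩
  · rintro _ ⟨i, hi, rfl⟩ t ht
    rw [(h.link_right hR hi).1 ht, h.mem_wall hR (tileIdx_pos _), tilePos_tileIdx]
    simp
  · rintro _ ⟨i, hi, rfl⟩ hw
    rw [h.mem_wall hR hi] at hw
    obtain ⟨a, ha⟩ := Nat.exists_eq_succ_of_ne_zero hw
    have hpos : tilePos i =
        ((tilePos (tileIdx (a, (tilePos i).2))).1 + 1, (tilePos (tileIdx (a, (tilePos i).2))).2) := by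
      rw [tilePos_tileIdx]; exact Prod.ext ha rfl
    exact ⟨_, (hR.tppi_iff _ _).2 ((h.y_tpp (tileIdx_pos _) hi).2 hpos), ⟨_, tileIdx_pos _, rfl⟩,
      _, (hR.tppi_iff _ _).2 (h.tpp_y (tileIdx_pos _)), ⟨_, tileIdx_pos _, rfl⟩⟩
  · rintro _ ⟨i, hi, rfl⟩ hw t ht t' ht'
    rw [h.mem_wall hR hi] at hw
    rw [(h.link_right hR hi).1 ht] at ht'
    rw [(h.link_succ hR (tileIdx_pos _)).1 ht', h.mem_wall hR (by omega), right_up i hi]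
    exact hw
  · rintro _ ⟨i, hi, rfl⟩
    exact ⟨_, (h.mem_tileVar hR hi _).2 rfl⟩
  · rintro p q hpq _ ⟨i, hi, rfl⟩ hp t ht hq
    rw [(h.link_right hR hi).1 ht, h.mem_tileVar hR (tileIdx_pos _), tilePos_tileIdx] at hq
    rw [h.mem_tileVar hR hi] at hp
    exact hpq (hp ▸ hq ▸ hhor _ _)
  · rintro p q hpq _ ⟨i, hi, rfl⟩ hp t ht t' ht' hq
    rw [(h.link_right hR hi).1 ht] at ht'
    rw [(h.link_succ hR (tileIdx_pos _)).1 ht', h.mem_tileVar hR (by omega), right_up i hi] at hq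
    rw [h.mem_tileVar hR hi] at hp
    exact hpq (hp ▸ hq ▸ hver _ _)

theorem sat_wordFormula (w : List D.Tile) (a : ℕ)
    (hw : ∀ i t, w[i]? = some t → τ (a + i) 0 = t) :
    Sat R (tilingValuation D x y τ) (x (2 * tileIdx (a, 0) - 1)) (D.wordFormula w) := by
  induction w generalizing a with
  | nil => simp
  | cons t₀ w ih =>
    rw [sat_wordFormula_cons]
    constructor
    · intro t ht
      rw [h.mem_tileVar hR (tileIdx_pos _), tilePos_tileIdx] at ht
      rw [← ht]
      exact hw 0 t₀ (by simp)
    · intro t ht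
      rw [(h.link_right hR (tileIdx_pos _)).1 ht, tilePos_tileIdx]
      exact ih (a + 1) fun i t hi => by
        rw [add_assoc, add_comm 1 i]
        exact hw (i + 1) t (by simpa using hi)

end DominoSequences

/-- In a class of region structures with a domino ready member, the formula of a word is
satisfiable if and only if the word starts the bottom row of a tiling. -/
theorem neg_formula_mem_logic_iff {S : Set RelStructure.{u}} (hS : S ⊆ RS)
    (hd : ∃ R ∈ S, DominoReady R) (D : TileSystem) (w : List D.Tile) :
    (D.formula w).neg ∈ logic S ↔ ¬ D.Tiles w := by
  constructor
  · rintro h ⟨τ, hhor, hver, hw⟩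
    obtain ⟨R, hRS, hd⟩ := hd
    obtain ⟨x, y, hxy⟩ := hd.exists_sequences
    refine h R hRS (tilingValuation D x y τ) (x (2 * tileIdx (0, 0) - 1)) ?_
    exact (sat_formula (hS hRS)).2 ⟨⟨⟨_, tileIdx_pos _, rfl⟩, hxy.tilingModel (hS hRS) hhor hver⟩,
      hxy.sat_wordFormula (hS hRS) w 0 (by simpa using hw)⟩
  · intro h R hRS V s hsat
    obtain ⟨⟨h1, h2⟩, h3⟩ := (sat_formula (hS hRS)).1 hsat
    exact h (h2.tiles (hS hRS) h1 h3)

/-! ### The composition table for regular closed sets -/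

/-- Eight relations defined from contact `C`, overlap `O`, parthood `P` and non-tangential parthood
`N` in the way of `topRel`, where these four satisfy the laws that they have for regular closed
sets. -/
structure IsMereotopology {α : Type u} (C O P N : α → α → Prop) (rel : RCC8 → α → α → Prop) :
    Prop where
  part_refl : ∀ x, P x x
  part_antisymm : ∀ x y, P x y → P y x → x = y
  part_trans : ∀ x y z, P x y → P y z → P x z
  part_of_ntp : ∀ x y, N x y → P x y
  ntp_part : ∀ x y z, N x y → P y z → N x z
  part_ntp : ∀ x y z, P x y → N y z → N x z
  contact_symm : ∀ x y, C x y → C y x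
  overlap_symm : ∀ x y, O x y → O y x
  contact_of_overlap : ∀ x y, O x y → C x y
  overlap_of_part : ∀ x y, P x y → O x y
  contact_part : ∀ x y z, C x y → P y z → C x z
  overlap_part : ∀ x y z, O x y → P y z → O x z
  contact_ntp : ∀ x y z, C x y → N y z → O x z
  dc_iff : ∀ x y, rel .dc x y ↔ ¬ C x y
  ec_iff : ∀ x y, rel .ec x y ↔ ¬ O x y ∧ C x y
  po_iff : ∀ x y, rel .po x y ↔ O x y ∧ ¬ P x y ∧ ¬ P y x
  eq_iff : ∀ x y, rel .eq x y ↔ x = y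
  tpp_iff : ∀ x y, rel .tpp x y ↔ P x y ∧ ¬ N x y ∧ x ≠ y
  ntpp_iff : ∀ x y, rel .ntpp x y ↔ N x y ∧ x ≠ y
  tppi_iff : ∀ x y, rel .tppi x y ↔ P y x ∧ ¬ N y x ∧ y ≠ x
  ntppi_iff : ∀ x y, rel .ntppi x y ↔ N y x ∧ y ≠ x

namespace IsMereotopology

variable {α : Type u} {C O P N : α → α → Prop} {rel : RCC8 → α → α → Prop}
  (h : IsMereotopology C O P N rel)
include h

theorem rel_unique (r q : RCC8) (x y : α) (h1 : rel r x y) (h2 : rel q x y) : r = q := by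
  obtain ⟨_, _, _, _, _, _, _, _, _, _, _, _, _, hdc, hec, hpo, heq, htpp, hntpp, htppi, hntppi⟩ := h
  cases r <;> cases q <;>
    simp only [hdc, hec, hpo, heq, htpp, hntpp, htppi, hntppi, reduceCtorEq] at h1 h2 ⊢ <;> grind

theorem rel_exists (x y : α) : ∃ r, rel r x y := by
  by_contra! hn
  have hdc := hn .dc
  have hec := hn .ec
  have hpo := hn .po
  have heq := hn .eq
  have htpp := hn .tpp
  have hntpp := hn .ntpp
  have htppi := hn .tppi
  have hntppi := hn .ntppi
  rw [h.dc_iff] at hdc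
  rw [h.ec_iff] at hec
  rw [h.po_iff] at hpo
  rw [h.eq_iff] at heq
  rw [h.tpp_iff] at htpp
  rw [h.ntpp_iff] at hntpp
  rw [h.tppi_iff] at htppi
  rw [h.ntppi_iff] at hntppi
  grind

theorem mem_compTable (x y z : α) (r₁ r₂ q : RCC8) (h1 : rel r₁ x y) (h2 : rel r₂ y z)
    (h3 : rel q x z) : q ∈ compTable r₁ r₂ := by
  obtain ⟨_, _, _, _, _, _, _, _, _, _, _, _, _, hdc, hec, hpo, heq, htpp, hntpp, htppi, hntppi⟩ := h
  cases r₁ <;> cases r₂ <;> cases q <;>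
    simp only [hdc, hec, hpo, heq, htpp, hntpp, htppi, hntppi, compTable, List.mem_cons,
      reduceCtorEq, or_false, or_true, List.not_mem_nil] at h1 h2 h3 ⊢ <;> grind

theorem isRegionStructure [Nonempty α] : IsRegionStructure ⟨α, rel⟩ where
  nonempty := ‹_›
  disjoint := h.rel_unique
  exhaustive := h.rel_exists
  eq_iff := h.eq_iff
  dc_symm x y hxy := (h.dc_iff _ _).2 fun h' => (h.dc_iff _ _).1 hxy (h.contact_symm _ _ h')
  ec_symm x y hxy := (h.ec_iff _ _).2
    ⟨fun h' => ((h.ec_iff _ _).1 hxy).1 (h.overlap_symm _ _ h'),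
      h.contact_symm _ _ ((h.ec_iff _ _).1 hxy).2⟩
  po_symm x y hxy := by
    have := (h.po_iff _ _).1 hxy
    exact (h.po_iff _ _).2 ⟨h.overlap_symm _ _ this.1, this.2.2, this.2.1⟩
  tppi_iff x y := (h.tppi_iff x y).trans (h.tpp_iff y x).symm
  ntppi_iff x y := (h.ntppi_iff x y).trans (h.ntpp_iff y x).symm
  comp r₁ r₂ x y z h1 h2 := by
    obtain ⟨q, hq⟩ := h.rel_exists x z
    exact ⟨q, h.mem_compTable x y z r₁ r₂ q h1 h2 hq, hq⟩

end IsMereotopology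

section Regular

variable {X : Type u} [TopologicalSpace X] {s t w : Set X}

theorem interior_inter_nonempty_of_subset_interior (hs : s ∈ regSets X)
    (hst : (s ∩ t).Nonempty) (htw : t ⊆ interior w) : (interior s ∩ interior w).Nonempty := by
  obtain ⟨p, hps, hpt⟩ := hst
  rw [← hs.2] at hps
  obtain ⟨q, hqw, hqs⟩ := mem_closure_iff.1 hps _ isOpen_interior (htw hpt)
  exact ⟨q, hqs, hqw⟩

theorem interior_nonempty_of_mem_regSets (hs : s ∈ regSets X) : (interior s).Nonempty := by
  rw [← closure_nonempty_iff, hs.2]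
  exact hs.1

theorem isRegionStructure_concrete {U : Set (Set X)} (hU : U ⊆ regSets X) (hne : U.Nonempty) :
    IsRegionStructure (concrete U) := by
  have : Nonempty U := hne.to_subtype
  refine IsMereotopology.isRegionStructure (α := U) (C := fun s t => (s.1 ∩ t.1).Nonempty)
    (O := fun s t => (interior s.1 ∩ interior t.1).Nonempty) (P := fun s t => s.1 ⊆ t.1)
    (N := fun s t => s.1 ⊆ interior t.1) (rel := fun r s t => topRel r s.1 t.1) ?_
  constructor
  · exact fun s => subset_rfl
  · exact fun s t h h' => Subtype.ext (h.antisymm h')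
  · exact fun s t w h h' => h.trans h'
  · exact fun s t h => h.trans interior_subset
  · exact fun s t w h h' => h.trans (interior_mono h')
  · exact fun s t w h h' => h.trans h'
  · exact fun s t h => by rwa [Set.inter_comm]
  · exact fun s t h => by rwa [Set.inter_comm]
  · exact fun s t h => h.mono (Set.inter_subset_inter interior_subset interior_subset)
  · intro s t h
    rw [Set.inter_eq_left.2 (interior_mono h)]
    exact interior_nonempty_of_mem_regSets (hU s.2)
  · exact fun s t w h h' => h.mono (Set.inter_subset_inter_right _ h')
  · exact fun s t w h h' => h.mono (Set.inter_subset_inter_right _ (interior_mono h'))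
  · exact fun s t w h h' => interior_inter_nonempty_of_subset_interior (hU s.2) h h'
  · exact fun s t => Set.not_nonempty_iff_eq_empty.symm
  · exact fun s t => and_congr Set.not_nonempty_iff_eq_empty.symm Set.nonempty_iff_ne_empty.symm
  · exact fun s t => and_congr_left' Set.nonempty_iff_ne_empty.symm
  · exact fun s t => Subtype.ext_iff.symm
  · exact fun s t => and_congr_right' (and_congr_right' Subtype.coe_ne_coe)
  · exact fun s t => and_congr_right' Subtype.coe_ne_coe
  · exact fun s t => and_congr_right' (and_congr_right' Subtype.coe_ne_coe)
  · exact fun s t => and_congr_right' Subtype.coe_ne_coe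

end Regular

/-! ### Concrete domino ready structures -/

/-- The number of the right neighbour of the `i`-th position. -/
def rightIdx (i : ℕ) : ℕ := tileIdx ((tilePos i).1 + 1, (tilePos i).2)

theorem rightIdx_eq {i : ℕ} (hi : 1 ≤ i) :
    rightIdx i = i + ((tilePos i).1 + (tilePos i).2 + 1) := by
  rw [rightIdx, tileIdx_right, Prod.mk.eta, tileIdx_tilePos hi]

theorem rightIdx_lt {i j : ℕ} (hi : 1 ≤ i) (hij : i < j) : rightIdx i < rightIdx j := by
  induction j, (show i + 1 ≤ j from hij) using Nat.le_induction with
  | base =>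
    rw [rightIdx_eq hi, rightIdx_eq (by omega)]
    rcases h : tilePos i with ⟨_ | a, b⟩
    · rw [tilePos_succ_of_zero hi h]; simp only; omega
    · rw [tilePos_succ_of_succ hi h]; simp only; omega
  | succ j hj ih =>
    refine (ih (by omega)).trans ?_
    rw [rightIdx_eq (by omega), rightIdx_eq (by omega)]
    rcases h : tilePos j with ⟨_ | a, b⟩
    · rw [tilePos_succ_of_zero (by omega) h]; simp only; omega
    · rw [tilePos_succ_of_succ (by omega) h]; simp only; omega

section

variable {X : Type u} [TopologicalSpace X] {f : X → ℝ} {U : Set (Set X)}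
  (hf : Continuous f) (ho : IsOpenMap f) (hs : Function.Surjective f)
include hf ho hs

theorem preimage_Icc_mem_regSets {a b : ℝ} (hab : a < b) :
    f ⁻¹' Set.Icc a b ∈ regSets X := by
  refine ⟨(Set.nonempty_Icc.2 hab.le).preimage hs, ?_⟩
  rw [← ho.preimage_interior_eq_interior_preimage hf, interior_Icc,
    ← ho.preimage_closure_eq_closure_preimage hf, closure_Ioo hab.ne]

theorem topRel_ntpp_preimage_Icc {a b c d : ℝ} (hab : a < b) (hca : c < a) (hbd : b < d) :
    topRel .ntpp (f ⁻¹' Set.Icc a b) (f ⁻¹' Set.Icc c d) := by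
  refine ⟨?_, fun h => ?_⟩
  · rw [← ho.preimage_interior_eq_interior_preimage hf, interior_Icc]
    exact Set.preimage_mono (Set.Icc_subset_Ioo hca hbd)
  · rw [hs.preimage_injective.eq_iff, Set.Icc_eq_Icc_iff hab.le] at h
    exact hca.ne' h.1

theorem topRel_tpp_preimage_Icc {a b c d : ℝ} (hab : a < b) :
    topRel .tpp (f ⁻¹' Set.Icc a b) (f ⁻¹' Set.Icc c d) ↔
      (c = a ∧ b < d) ∨ (c < a ∧ b = d) := by
  simp only [topRel]
  rw [← ho.preimage_interior_eq_interior_preimage hf, interior_Icc,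
    hs.preimage_subset_preimage_iff, hs.preimage_subset_preimage_iff, Ne,
    hs.preimage_injective.eq_iff, Set.Icc_eq_Icc_iff hab.le, Set.Icc_subset_Icc_iff hab.le,
    Set.Icc_subset_Ioo_iff hab.le]
  grind

/-- Over a space with a continuous open map onto the real line, the preimages of intervals provide
the sequences that make a structure domino ready: the left and the right ends of the intervals grow
alternately along the first sequence, and `y i` combines the left end of its source `x (2 * i - 1)`
with the right end of its target. -/
theorem dominoReady_concrete (hU : ∀ a b : ℝ, a < b → f ⁻¹' Set.Icc a b ∈ U) :
    DominoReady (concrete U) := by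
  let I : ℕ → ℕ → (concrete U).carrier := fun a b =>
    ⟨f ⁻¹' Set.Icc (-(a : ℝ)) (b + 1), hU _ _ (by
      have h1 : (0 : ℝ) ≤ a := a.cast_nonneg
      have h2 : (0 : ℝ) ≤ b := b.cast_nonneg
      linarith)⟩
  have neg_lt : ∀ a b : ℕ, -(a : ℝ) < b + 1 := fun a b => by
    have h1 : (0 : ℝ) ≤ a := a.cast_nonneg
    have h2 : (0 : ℝ) ≤ b := b.cast_nonneg
    linarith
  have htpp : ∀ a b c d, (concrete U).rel .tpp (I a b) (I c d) ↔
      (c = a ∧ b < d) ∨ (a < c ∧ b = d) := by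
    intro a b c d
    refine (topRel_tpp_preimage_Icc hf ho hs (neg_lt a b)).trans ?_
    norm_num
  have hntpp : ∀ a b c d, a < c → b < d → (concrete U).rel .ntpp (I a b) (I c d) := by
    intro a b c d hac hbd
    refine topRel_ntpp_preimage_Icc hf ho hs (neg_lt a b) ?_ ?_
    · exact neg_lt_neg (Nat.cast_lt.2 hac)
    · simpa using hbd
  -- The region number `k` is `[-((k + 1) / 2), k / 2 + 1]`, with quotients rounded down, so that
  -- the odd numbers `2 * i - 1` belong to the intervals `[-i, i]`.
  refine ⟨fun k => I ((k + 1) / 2) (k / 2), fun i => I i (rightIdx i - 1), fun i j hi hj => ?_⟩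
  have hr := rightIdx_eq hi
  refine ⟨?_, fun hij => ?_, ?_, ?_, fun hij => ?_⟩
  · rw [htpp]; omega
  · exact hntpp _ _ _ _ (by omega) (by omega)
  · rw [htpp]; omega
  · rw [htpp]
    have e : tilePos j = ((tilePos i).1 + 1, (tilePos i).2) ↔ j = rightIdx i := by
      constructor
      · intro h
        rw [rightIdx, ← h, tileIdx_tilePos hj]
      · rintro rfl
        exact tilePos_tileIdx _
    rw [e]
    omega
  · have := rightIdx_lt hi hij
    exact hntpp _ _ _ _ hij (by omega)

end

theorem DominoReady.of_isomorphic {R : RelStructure.{u}} {R' : RelStructure.{v}}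
    (h : R.Isomorphic R') (hR : DominoReady R') : DominoReady R := by
  obtain ⟨e, he⟩ := h
  obtain ⟨x, y, h⟩ := hR
  refine ⟨fun i => e.symm (x i), fun i => e.symm (y i), fun i j hi hj => ?_⟩
  simpa only [he, e.apply_symm_apply] using h i j hi hj

/-! ### Hyper-rectangles -/

section Rect

variable {n : ℕ}

theorem rectSets_subset_regSets : rectSets n ⊆ regSets (EuclideanSpace ℝ (Fin n)) := by
  rintro _ ⟨C, hC, rfl⟩
  let e := EuclideanSpace.equiv (Fin n) ℝ
  have he : {x : EuclideanSpace ℝ (Fin n) | ∀ i, x i ∈ C i} =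
      e.toHomeomorph ⁻¹' Set.pi Set.univ C := by
    ext x; simp [e, Set.mem_pi]
  have hi : ∀ i, closure (interior (C i)) = C i := by
    intro i
    obtain ⟨a, ha, b, hb, hab⟩ := (hC i).2.2.exists_lt
    have hne : (interior (C i)).Nonempty := by
      have : Set.Ioo a b ⊆ interior (C i) :=
        interior_maximal (Set.Ioo_subset_Icc_self.trans ((hC i).2.1.out ha hb)) isOpen_Ioo
      exact (Set.nonempty_Ioo.2 hab).mono this
    have hc : Convex ℝ (C i) := (hC i).2.1.convex
    rw [hc.closure_interior_eq_closure_of_nonempty_interior hne, (hC i).1.closure_eq]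
  rw [he]
  constructor
  · exact (Set.univ_pi_nonempty_iff.2 fun i => (hC i).2.2.nonempty).preimage
      e.toHomeomorph.surjective
  · rw [← e.toHomeomorph.preimage_interior, ← e.toHomeomorph.preimage_closure,
      interior_pi_set Set.finite_univ, closure_pi_set]
    simp only [hi]

theorem rectSets_subset_convSets : rectSets n ⊆ convSets n := by
  intro s hs
  refine ⟨rectSets_subset_regSets hs, ?_⟩
  obtain ⟨C, hC, rfl⟩ := hs
  intro x hx y hy a b ha hb hab i
  exact (hC i).2.1.convex (hx i) (hy i) ha hb hab

theorem dominoReady_of_rectSets_subset (hn : 0 < n) {U : Set (Set (EuclideanSpace ℝ (Fin n)))}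
    (hU : rectSets n ⊆ U) : DominoReady (concrete U) := by
  classical
  have ho : IsOpenMap fun x : EuclideanSpace ℝ (Fin n) => x ⟨0, hn⟩ :=
    (isOpenMap_eval (⟨0, hn⟩ : Fin n)).comp
      (EuclideanSpace.equiv (Fin n) ℝ).toHomeomorph.isOpenMap
  refine dominoReady_concrete (f := fun x => x ⟨0, hn⟩) (by fun_prop) ho
    (fun r => ⟨WithLp.toLp 2 fun _ => r, rfl⟩) fun a b hab => hU ?_
  -- The other coordinates range over the whole line, so that they do not affect the relations.
  refine ⟨fun i => if i = ⟨0, hn⟩ then Set.Icc a b else Set.univ, fun i => ?_, ?_⟩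
  · dsimp only
    split_ifs
    · exact ⟨isClosed_Icc, Set.ordConnected_Icc,
        ⟨a, Set.left_mem_Icc.2 hab.le, b, Set.right_mem_Icc.2 hab.le, hab.ne⟩⟩
    · exact ⟨isClosed_univ, Set.ordConnected_univ, Set.nontrivial_univ⟩
  · ext x
    simp only [Set.mem_preimage, Set.mem_ofPred_eq]
    constructor
    · intro h i
      split_ifs with hi
      · exact hi ▸ h
      · trivial
    · intro h
      simpa using h ⟨0, hn⟩

end Rect

/-! ### Substructures and topological spaces -/

/-- The substructure with full domain shows that the substructures of the members of a class with a
domino ready member form another such class. -/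
theorem exists_dominoReady_substructures {S : Set RelStructure.{u}}
    (hS : S ⊆ RS) (h : ∃ R ∈ S, DominoReady R) : ∃ R ∈ substructures S, DominoReady R := by
  obtain ⟨R, hRS, hR⟩ := h
  refine ⟨R.restrict Set.univ, ⟨R, hRS, Set.univ, ?_, rfl⟩,
    hR.of_isomorphic ⟨Equiv.Set.univ R.carrier, fun r x y => Iff.rfl⟩⟩
  have := (hS hRS).nonempty
  exact Set.univ_nonempty

theorem substructures_subset_RS {S : Set RelStructure.{u}} (hS : S ⊆ RS) :
    substructures S ⊆ RS := by
  rintro _ ⟨R, hRS, W, hW, rfl⟩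
  have hR := hS hRS
  exact {
    nonempty := hW.to_subtype
    disjoint := fun r q x y => hR.disjoint r q x.1 y.1
    exhaustive := fun x y => hR.exhaustive x.1 y.1
    eq_iff := fun x y => (hR.eq_iff x.1 y.1).trans Subtype.ext_iff.symm
    dc_symm := fun x y => hR.dc_symm x.1 y.1
    ec_symm := fun x y => hR.ec_symm x.1 y.1
    po_symm := fun x y => hR.po_symm x.1 y.1
    tppi_iff := fun x y => hR.tppi_iff x.1 y.1
    ntppi_iff := fun x y => hR.ntppi_iff x.1 y.1
    comp := fun r₁ r₂ x y z => hR.comp r₁ r₂ x.1 y.1 z.1 }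

theorem TOP_subset_RS : TOP.{u} ⊆ RS := by
  rintro _ ⟨X, _, _, rfl⟩
  exact isRegionStructure_concrete subset_rfl ⟨Set.univ, Set.univ_nonempty, by simp⟩

theorem exists_dominoReady_TOP : ∃ R ∈ TOP.{u}, DominoReady R :=
  ⟨_, ⟨ULift.{u} ℝ, inferInstance, inferInstance, rfl⟩,
    dominoReady_concrete continuous_uliftDown Homeomorph.ulift.isOpenMap
      Homeomorph.ulift.surjective fun _ _ hab =>
        preimage_Icc_mem_regSets continuous_uliftDown Homeomorph.ulift.isOpenMap
          Homeomorph.ulift.surjective hab⟩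

/-! ### A Turing machine with an undecidable halting problem -/

open Turing in
theorem trNat_two_pow (n : ℕ) : PartrecToTM2.trNat (2 ^ n) =
    List.replicate n PartrecToTM2.Γ'.bit0 ++ [PartrecToTM2.Γ'.bit1] := by
  have h : ∀ n, ∃ p : PosNum, ((2 ^ n : ℕ) : Num) = Num.pos p ∧ PartrecToTM2.trPosNum p =
      List.replicate n PartrecToTM2.Γ'.bit0 ++ [PartrecToTM2.Γ'.bit1] := by
    intro n
    induction n with
    | zero => exact ⟨PosNum.one, rfl, rfl⟩
    | succ n ih =>
      obtain ⟨p, hp, hl⟩ := ih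
      refine ⟨PosNum.bit0 p, ?_, ?_⟩
      · have e : ((2 ^ (n + 1) : ℕ) : Num) = ((2 ^ n : ℕ) : Num) + ((2 ^ n : ℕ) : Num) := by
          rw [← Nat.cast_add, pow_succ]; congr 1; ring
        rw [e, hp, Num.bit0_of_bit0]
        rfl
      · rw [PartrecToTM2.trPosNum, hl]; rfl
  obtain ⟨p, hp, hl⟩ := h n
  rw [PartrecToTM2.trNat, hp, ← hl]
  rfl

/-- There is a partial recursive function whose domain, restricted to powers of two, is not
decidable: let it run the program whose number is the exponent. -/
theorem exists_partrec_undecidable : ∃ f : ℕ →. ℕ, Partrec f ∧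
    ¬ ComputablePred fun n => (f (2 ^ (n + 1))).Dom := by
  have hpow : Primrec fun k : ℕ => 2 ^ k :=
    (Primrec.nat_rec₁ (f := fun _ m => m * 2) 1
      (Primrec.nat_mul.comp Primrec.snd (Primrec.const 2)).to₂).of_eq fun k => by
        induction k with
        | zero => rfl
        | succ k ih => rw [pow_succ, ← ih]
  have hlog : Primrec fun m : ℕ => Nat.findGreatest (fun k => 2 ^ k ≤ m) m :=
    Primrec.nat_findGreatest (p := fun m k => 2 ^ k ≤ m) Primrec.id
      (Primrec.nat_le.comp (hpow.comp Primrec.snd) Primrec.fst)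
  refine ⟨fun m => (Denumerable.ofNat Nat.Partrec.Code
    (Nat.findGreatest (fun k => 2 ^ k ≤ m) m - 1)).eval 0, ?_, ?_⟩
  · exact Nat.Partrec.Code.eval_part.comp ((Computable.ofNat _).comp
      (Primrec.nat_sub.comp hlog (Primrec.const 1)).to_comp) (Computable.const 0)
  · intro h
    refine ComputablePred.halting_problem 0 ?_
    refine ComputablePred.computable_of_manyOneReducible ?_ h
    refine ⟨Encodable.encode, Computable.encode, fun c => ?_⟩
    have e : ∀ n, Nat.findGreatest (fun k => 2 ^ k ≤ 2 ^ (n + 1)) (2 ^ (n + 1)) = n + 1 := by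
      intro n
      rw [Nat.findGreatest_eq_iff]
      refine ⟨Nat.lt_two_pow_self.le, fun _ => le_rfl, fun k hk _ h => ?_⟩
      exact absurd h (not_le.2 (Nat.pow_lt_pow_right one_lt_two hk))
    simp only [e, Nat.add_sub_cancel, Denumerable.ofNat_encode]

open Turing in
theorem exists_turingMachine : ∃ (Γ Λ : Type) (_ : Inhabited Γ) (_ : Fintype Γ) (_ : Inhabited Λ)
    (M : TM0.Machine Γ Λ) (S : Finset Λ) (c d e : Γ), TM0.Supports M (S : Set Λ) ∧
    ¬ ComputablePred fun n => (TM0.eval M (c :: d :: List.replicate (n + 1) e)).Dom := by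
  classical
  obtain ⟨f, hf, hund⟩ := exists_partrec_undecidable
  obtain ⟨code, hcode⟩ := ToPartrec.Code.exists_code (Nat.Partrec'.part_iff₁.2 hf)
  let : Inhabited PartrecToTM2.Λ' := ⟨PartrecToTM2.trNormal code PartrecToTM2.Cont'.halt⟩
  let : Fintype PartrecToTM2.K' := ⟨{.main, .rev, .aux, .stack}, by rintro (_ | _ | _ | _) <;> simp⟩
  let sym : Bool → PartrecToTM2.Γ' → TM2to1.Γ' PartrecToTM2.K' (fun _ => PartrecToTM2.Γ') :=
    fun b a => (b, Function.update (fun _ => none) PartrecToTM2.K'.main (some a))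
  let M1 := TM2to1.tr PartrecToTM2.tr
  let S := TM1to0.trStmts M1 (TM2to1.trSupp PartrecToTM2.tr
    (PartrecToTM2.codeSupp code PartrecToTM2.Cont'.halt))
  refine ⟨_, _, inferInstance, inferInstance, inferInstance, TM1to0.tr M1, S, sym true .cons,
    sym false .bit1, sym false .bit0,
    TM1to0.tr_supports M1 (TM2to1.tr_supports _ (PartrecToTM2.tr_supports _ _)), ?_⟩
  intro h
  refine hund (h.of_eq fun n => ?_)
  have hinit : sym true .cons :: sym false .bit1 :: List.replicate (n + 1) (sym false .bit0) =
      TM2to1.trInit PartrecToTM2.K'.main (PartrecToTM2.trList [2 ^ (n + 1)]) := by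
    have hl : (PartrecToTM2.trList [2 ^ (n + 1)]).reverse =
        .cons :: .bit1 :: List.replicate (n + 1) .bit0 := by
      simp [PartrecToTM2.trList, trNat_two_pow]
    rw [TM2to1.trInit, hl]
    exact congrArg (fun l => _ :: _ :: l) List.map_replicate.symm
  rw [hinit, TM1to0.tr_eval]
  refine (TM2to1.tr_eval_dom PartrecToTM2.tr _ _).trans ?_
  have hi : TM2.init (Λ := PartrecToTM2.Λ') (σ := Option PartrecToTM2.Γ') PartrecToTM2.K'.main
      (PartrecToTM2.trList [2 ^ (n + 1)]) = PartrecToTM2.init code [2 ^ (n + 1)] := by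
    simp only [TM2.init, PartrecToTM2.init]
    congr 1
    funext k
    cases k <;> rfl
  have hv := hcode (2 ^ (n + 1) ::ᵥ List.Vector.nil)
  simp only [List.Vector.head_cons] at hv
  change (StateTransition.eval _ _).Dom ↔ _
  rw [hi, PartrecToTM2.tr_eval]
  change (ToPartrec.Code.eval code [2 ^ (n + 1)]).Dom ↔ _
  change ToPartrec.Code.eval code [2 ^ (n + 1)] = _ at hv
  rw [hv]
  rfl

/-! ### Turing machines as tile systems -/

section MachineTiles

open Turing

variable {Γ Λ : Type} [Inhabited Γ] [Inhabited Λ]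

/-- A tile at horizontal position `a` of the row for a configuration of a Turing machine. The tape
is folded at the head, so that the tile holds the symbols number `a` and `-a - 1`, counted from the
head, and those of the next position. The state and the symbol under the head appear in every tile
of the row. -/
@[ext]
structure MachineTile (Γ Λ : Type) where
  /-- the tile stands in the leftmost column -/
  first : Bool
  /-- the tile belongs to the part of the bottom row that is blank from the next position on -/
  tail : Bool
  /-- the state of the configuration -/
  state : Λ
  /-- the symbol under the head -/
  head : Γ
  /-- the symbols number `a` and `-a - 1` -/
  cell : Γ × Γ
  /-- the symbols number `a + 1` and `-a - 2` -/
  next : Γ × Γ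

noncomputable instance [Fintype Γ] [Fintype Λ] : Fintype (MachineTile Γ Λ) :=
  Fintype.ofInjective
    (fun t : MachineTile Γ Λ => (t.first, t.tail, t.state, t.head, t.cell, t.next)) fun t t' h => by
      simp only [Prod.mk.injEq] at h
      exact MachineTile.ext h.1 h.2.1 h.2.2.1 h.2.2.2.1 h.2.2.2.2.1 h.2.2.2.2.2

/-- The symbols in `t'` arise from those in the tile `t` below by an instruction. A move shifts both
halves of the folded tape, one of them away from the leftmost column and the other one towards
it. -/
def MachineTile.Updates {Λ : Type} (t t' : MachineTile Γ Λ) : TM0.Stmt Γ → Prop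
  | .move .right => t'.cell.1 = t.next.1 ∧ t'.next.2 = t.cell.2 ∧
      (t.first = true → t'.cell.2 = t.cell.1)
  | .move .left => t'.cell.2 = t.next.2 ∧ t'.next.1 = t.cell.1 ∧
      (t.first = true → t'.cell.1 = t.cell.2)
  | .write a => t'.cell = if t.first then (a, t.cell.2) else t.cell

/-- The tile system of a Turing machine with the states restricted to the finite set `S`. Tilings
describe the infinite runs, with one configuration in each row. -/
noncomputable def machineTiles [Fintype Γ] (M : TM0.Machine Γ Λ) (S : Finset Λ) : TileSystem where
  Tile := MachineTile Γ S
  hor t t' := t'.first = false ∧ t'.state = t.state ∧ t'.head = t.head ∧ t'.cell = t.next ∧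
    (t.tail = true → t'.tail = true ∧ t'.next = (default, default))
  ver t t' := t'.first = t.first ∧ (t'.first = true → t'.head = t'.cell.1) ∧
    ∃ q st, M t.state t.head = some (q, st) ∧ t'.state = q ∧ t.Updates t' st

/-- The row `r` of tiles describes the configuration `c`. -/
structure Represents {S : Finset Λ} (r : ℕ → MachineTile Γ S) (c : TM0.Cfg Γ Λ) : Prop where
  first : ∀ a, (r a).first = decide (a = 0)
  state : ∀ a, ((r a).state : Λ) = c.q
  head : ∀ a, (r a).head = c.Tape.head
  cell : ∀ a : ℕ, (r a).cell = (c.Tape.nth a, c.Tape.nth (-a - 1))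

theorem Represents.step [Fintype Γ] {M : TM0.Machine Γ Λ} {S : Finset Λ}
    {r r' : ℕ → (machineTiles M S).Tile} {c : TM0.Cfg Γ Λ} (h : Represents (S := S) r c)
    (hr : ∀ a, (machineTiles M S).hor (r a) (r (a + 1)))
    (hr' : ∀ a, (machineTiles M S).hor (r' a) (r' (a + 1)))
    (hv : ∀ a, (machineTiles M S).ver (r a) (r' a)) :
    ∃ c', TM0.step M c = some c' ∧ Represents (S := S) r' c' := by
  obtain ⟨q, T⟩ := c
  have hM : ∃ q' st, M q T.head = some (q', st) := by
    obtain ⟨-, -, q', st, hM, -⟩ := hv 0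
    rw [h.state, h.head] at hM
    exact ⟨q', st, hM⟩
  obtain ⟨q', st, hM⟩ := hM
  have hU : ∀ a, ((r' a).state : Λ) = q' ∧ (r a).Updates (r' a) st := by
    intro a
    obtain ⟨-, -, q₁, st₁, hM₁, h1, h2⟩ := hv a
    rw [h.state, h.head, hM] at hM₁
    obtain ⟨rfl, rfl⟩ : q' = q₁ ∧ st = st₁ := by simpa using hM₁
    exact ⟨h1, h2⟩
  have hfirst : ∀ a, (r' a).first = decide (a = 0) := fun a => (hv a).1.trans (h.first a)
  have hhead : ∀ a, (r' a).head = (r' 0).cell.1 := by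
    intro a
    induction a with
    | zero => exact (hv 0).2.1 (by simp [hfirst])
    | succ a ih => rw [(hr' a).2.2.1, ih]
  have hnext : ∀ a, (r a).next = (T.nth (a + 1 : ℕ), T.nth (-(a + 1 : ℕ) - 1)) := fun a => by
    rw [← (hr a).2.2.2.1, h.cell]
  have hn1 : ∀ a, (r a).next.1 = T.nth (a + 1 : ℕ) := fun a => congrArg Prod.fst (hnext a)
  have hn2 : ∀ a, (r a).next.2 = T.nth (-(a + 1 : ℕ) - 1) := fun a => congrArg Prod.snd (hnext a)
  have hc1 : ∀ a, (r a).cell.1 = T.nth a := fun a => congrArg Prod.fst (h.cell a)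
  have hc2 : ∀ a : ℕ, (r a).cell.2 = T.nth (-a - 1) := fun a => congrArg Prod.snd (h.cell a)
  have finish : ∀ T' : Tape Γ, (∀ a : ℕ, (r' a).cell = (T'.nth a, T'.nth (-a - 1))) →
      Represents (S := S) r' ⟨q', T'⟩ := fun T' hT' => by
    refine ⟨hfirst, fun a => (hU a).1, fun a => ?_, hT'⟩
    rw [hhead, hT', ← Tape.nth_zero]
    rfl
  refine ⟨_, by rw [TM0.step, hM]; rfl, finish _ ?_⟩
  intro a
  match st, hU with
  | .write w, hU =>
    have hu : (r' a).cell = if (r a).first then (w, (r a).cell.2) else (r a).cell := (hU a).2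
    rw [hu, h.first, h.cell]
    dsimp only
    rw [Tape.write_nth, Tape.write_nth, if_neg (show ¬ (-(a : ℤ) - 1 = 0) by omega)]
    rcases Nat.eq_zero_or_pos a with rfl | ha
    · simp
    · simp [ha.ne']
  | .move .right, hU =>
    dsimp only
    rw [Tape.move_right_nth, Tape.move_right_nth, show -(a : ℤ) - 1 + 1 = -a by ring]
    refine Prod.ext ((hU a).2.1.trans (hn1 a)) ?_
    cases a with
    | zero => exact ((hU 0).2.2.2 (by simp [h.first])).trans (hc1 0)
    | succ a =>
      rw [(hr' a).2.2.2.1]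
      exact ((hU a).2.2.1.trans (hc2 a)).trans
        (congrArg T.nth (show -(a : ℤ) - 1 = -(a + 1 : ℕ) by push_cast; ring))
  | .move .left, hU =>
    dsimp only
    rw [Tape.move_left_nth, Tape.move_left_nth]
    refine Prod.ext ?_ ((hU a).2.1.trans ?_)
    · cases a with
      | zero => exact ((hU 0).2.2.2 (by simp [h.first])).trans (hc2 0)
      | succ a =>
        rw [(hr' a).2.2.2.1]
        exact ((hU a).2.2.1.trans (hc1 a)).trans
          (congrArg T.nth (show (a : ℤ) = (a + 1 : ℕ) - 1 by push_cast; ring))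
    · exact (hn2 a).trans
        (congrArg T.nth (show -((a + 1 : ℕ) : ℤ) - 1 = -a - 1 - 1 by push_cast; ring))

/-- The tile at position `a` of the row that describes a configuration. -/
def configTile {S : Finset Λ} (c : TM0.Cfg Γ Λ) (hc : c.q ∈ S) (tail : Bool) (a : ℕ) :
    MachineTile Γ S where
  first := decide (a = 0)
  tail := tail
  state := ⟨c.q, hc⟩
  head := c.Tape.head
  cell := (c.Tape.nth a, c.Tape.nth (-a - 1))
  next := (c.Tape.nth (a + 1 : ℕ), c.Tape.nth (-(a + 1 : ℕ) - 1))

theorem ver_configTile [Fintype Γ] {M : TM0.Machine Γ Λ} {S : Finset Λ} {c c' : TM0.Cfg Γ Λ}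
    (hc : c.q ∈ S) (hc' : c'.q ∈ S) (h : TM0.step M c = some c') (b b' : Bool) (a : ℕ) :
    (machineTiles M S).ver (configTile c hc b a) (configTile c' hc' b' a) := by
  obtain ⟨q, T⟩ := c
  rw [TM0.step, Option.map_eq_some_iff] at h
  obtain ⟨⟨q', st⟩, hM, rfl⟩ := h
  refine ⟨rfl, ?_, q', st, hM, rfl, ?_⟩
  · intro ha
    obtain rfl : a = 0 := by simpa [configTile] using ha
    exact (Tape.nth_zero _).symm
  · match st with
    | .write w =>
      simp only [configTile, MachineTile.Updates, Tape.write_nth]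
      rw [if_neg (show ¬ (-(a : ℤ) - 1 = 0) by omega)]
      rcases Nat.eq_zero_or_pos a with rfl | ha
      · simp
      · simp [ha.ne']
    | .move .right =>
      simp only [configTile, MachineTile.Updates, Tape.move_right_nth]
      refine ⟨by push_cast; rfl, congrArg _ (by push_cast; ring), fun ha => ?_⟩
      obtain rfl : a = 0 := by simpa using ha
      rfl
    | .move .left =>
      simp only [configTile, MachineTile.Updates, Tape.move_left_nth]
      refine ⟨congrArg _ (by push_cast; ring), congrArg _ (by push_cast; ring), fun ha => ?_⟩
      obtain rfl : a = 0 := by simpa using ha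
      rfl

/-- The beginning of the bottom row, for an input of the form `c, d, e, …, e`: the last tile of the
word switches to the blank part of the row. -/
def inputWord {S : Finset Λ} (hS : default ∈ S) (c d e : Γ) (n : ℕ) : List (MachineTile Γ S) :=
  ⟨true, false, ⟨default, hS⟩, c, (c, default), (d, default)⟩ ::
  ⟨false, false, ⟨default, hS⟩, c, (d, default), (e, default)⟩ ::
  (List.replicate n ⟨false, false, ⟨default, hS⟩, c, (e, default), (e, default)⟩ ++
    [⟨false, true, ⟨default, hS⟩, c, (e, default), (default, default)⟩])

theorem tape_mk₁_nth_nat (l : List Γ) (a : ℕ) : (Tape.mk₁ l).nth a = l.getI a := by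
  rw [Tape.mk₁, Tape.mk₂, Tape.mk'_nth_nat, ListBlank.nth_mk]

theorem tape_mk₁_nth_neg (l : List Γ) (a : ℕ) : (Tape.mk₁ l).nth (-a - 1) = default := by
  rw [show -(a : ℤ) - 1 = Int.negSucc a by omega]
  change (ListBlank.mk ([] : List Γ)).nth a = default
  rw [ListBlank.nth_mk, List.getI_nil]

theorem getI_replicate (e : Γ) (n k : ℕ) :
    (List.replicate n e).getI k = if k < n then e else default := by
  rw [← List.getD_default_eq_getI, List.getD_eq_getElem?_getD, List.getElem?_replicate]
  split_ifs <;> rfl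

theorem getElem?_inputWord {S : Finset Λ} (hS : default ∈ S) (c d e : Γ) (n i : ℕ)
    (hi : i ≤ n + 2) :
    (inputWord hS c d e n)[i]? = some (configTile
      (TM0.init (c :: d :: List.replicate (n + 1) e)) hS (decide (n + 2 ≤ i)) i) := by
  have hhead : (Tape.mk₁ (c :: d :: List.replicate (n + 1) e)).head = c := by
    rw [← Tape.nth_zero]
    exact tape_mk₁_nth_nat _ 0
  simp only [configTile, TM0.init, hhead, tape_mk₁_nth_nat, tape_mk₁_nth_neg]
  rcases i with _ | _ | k
  · simp [inputWord]
  · simp [inputWord, getI_replicate]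
  · simp only [inputWord, List.getElem?_cons_succ, List.getI_cons_succ, getI_replicate]
    rcases Nat.lt_or_ge k n with hk | hk
    · rw [List.getElem?_append_left (by simpa using hk), List.getElem?_replicate, if_pos hk,
        if_pos (by omega), if_pos (by omega)]
      simp [hk]
    · obtain rfl : k = n := by omega
      rw [List.getElem?_append_right (by simp)]
      simp

theorem length_inputWord {S : Finset Λ} (hS : default ∈ S) (c d e : Γ) (n : ℕ) :
    (inputWord hS c d e n).length = n + 3 := by
  simp [inputWord]

theorem tiles_inputWord_iff [Fintype Γ] {M : TM0.Machine Γ Λ} {S : Finset Λ}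
    (hM : TM0.Supports M (S : Set Λ)) (c d e : Γ) (n : ℕ) :
    (machineTiles M S).Tiles (inputWord (S := S) hM.1 c d e n) ↔
      ¬ (TM0.eval M (c :: d :: List.replicate (n + 1) e)).Dom := by
  set l := c :: d :: List.replicate (n + 1) e with hl
  have hdom : (TM0.eval M l).Dom ↔
      ∃ c', StateTransition.Reaches (TM0.step M) (TM0.init l) c' ∧ TM0.step M c' = none := by
    simp only [← StateTransition.mem_eval]
    exact Part.dom_iff_mem (o := StateTransition.eval (TM0.step M) (TM0.init l))
  rw [hdom]
  constructor
  · rintro ⟨τ, hhor, hver, hword⟩ ⟨c', hc', hnone⟩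
    have h0 : Represents (S := S) (fun a => τ a 0) (TM0.init l) := by
      have hin : ∀ a, a ≤ n + 2 → τ a 0 = configTile (TM0.init l) hM.1 (decide (n + 2 ≤ a)) a :=
        fun a ha => hword a _ (getElem?_inputWord hM.1 c d e n a ha)
      have hout : ∀ a, τ a 0 = configTile (TM0.init l) hM.1 (decide (n + 2 ≤ a)) a := by
        intro a
        rcases Nat.lt_or_ge a (n + 2) with ha | ha
        · exact hin a ha.le
        induction a, ha using Nat.le_induction with
        | base => exact hin _ le_rfl
        | succ a ha ih =>
          obtain ⟨h1, h2, h3, h4, h5⟩ := hhor a 0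
          rw [ih] at h2 h3 h4 h5
          obtain ⟨h5, h6⟩ := h5 (by simpa [configTile] using ha)
          refine MachineTile.ext (h1.trans (by simp [configTile]))
            (h5.trans (by simp [configTile]; omega)) h2 h3 h4 (h6.trans ?_)
          simp only [configTile, TM0.init, tape_mk₁_nth_nat, tape_mk₁_nth_neg]
          obtain ⟨k, rfl⟩ := Nat.exists_eq_add_of_le' ha
          simp only [hl, show k + (n + 2) + 1 + 1 = k + n + 2 + 1 + 1 by ring,
            List.getI_cons_succ, getI_replicate]
          rw [if_neg (by omega)]
      constructor <;> intro a <;> rw [hout] <;> rfl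
    have hall : ∀ c', StateTransition.Reaches (TM0.step M) (TM0.init l) c' →
        ∃ b, Represents (S := S) (fun a => τ a b) c' := by
      intro c' hc'
      induction hc' with
      | refl => exact ⟨0, h0⟩
      | tail _ hstep ih =>
        obtain ⟨b, hb⟩ := ih
        obtain ⟨c'', h1, h2⟩ := hb.step (fun a => hhor a b) (fun a => hhor a (b + 1))
          (fun a => hver a b)
        obtain rfl := Option.some.inj (h1.symm.trans hstep)
        exact ⟨b + 1, h2⟩
    obtain ⟨b, hb⟩ := hall c' hc'
    obtain ⟨c'', h1, -⟩ := hb.step (fun a => hhor a b) (fun a => hhor a (b + 1))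
      (fun a => hver a b)
    rw [hnone] at h1
    cases h1
  · intro hn
    let run : ℕ → TM0.Cfg Γ Λ := fun t =>
      Nat.rec (TM0.init l) (fun _ c => (TM0.step M c).getD c) t
    have hreach : ∀ t, StateTransition.Reaches (TM0.step M) (TM0.init l) (run t) ∧
        TM0.step M (run t) = some (run (t + 1)) := by
      have hs : ∀ t, StateTransition.Reaches (TM0.step M) (TM0.init l) (run t) →
          TM0.step M (run t) = some (run (t + 1)) := by
        intro t ht
        cases h : TM0.step M (run t) with
        | none => exact absurd ⟨_, ht, h⟩ hn
        | some c' =>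
          change _ = some ((TM0.step M (run t)).getD (run t))
          rw [h]
          rfl
      intro t
      induction t with
      | zero => exact ⟨.refl, hs 0 .refl⟩
      | succ t ih =>
        have : StateTransition.Reaches (TM0.step M) (TM0.init l) (run (t + 1)) :=
          ih.1.tail ih.2
        exact ⟨this, hs (t + 1) this⟩
    have hS : ∀ t, (run t).q ∈ S := by
      intro t
      induction t with
      | zero => exact hM.1
      | succ t ih => exact TM0.step_supports M hM (hreach t).2 ih
    refine ⟨fun a b => configTile (run b) (hS b) (decide (b = 0 ∧ n + 2 ≤ a)) a, ?_, ?_, ?_⟩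
    · intro a b
      refine ⟨by simp [configTile], rfl, rfl, rfl, fun ht => ?_⟩
      obtain ⟨rfl, ha⟩ : b = 0 ∧ n + 2 ≤ a := by simpa [configTile] using ht
      refine ⟨by simp [configTile]; omega, ?_⟩
      change (Tape.nth (Tape.mk₁ l) _, Tape.nth (Tape.mk₁ l) _) = _
      rw [tape_mk₁_nth_nat, tape_mk₁_nth_neg]
      obtain ⟨k, rfl⟩ := Nat.exists_eq_add_of_le' ha
      simp only [hl, show k + (n + 2) + 1 + 1 = k + n + 2 + 1 + 1 by ring,
        List.getI_cons_succ, getI_replicate]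
      rw [if_neg (by omega)]
    · intro a b
      exact ver_configTile _ _ (hreach b).2 _ _ _
    · intro i t ht
      have hi : i ≤ n + 2 := by
        have h1 : i < (inputWord (S := S) hM.1 c d e n).length :=
          (List.getElem?_eq_some_iff.1 ht).1
        have h2 := length_inputWord (S := S) hM.1 c d e n
        omega
      have h0 := (getElem?_inputWord (S := S) hM.1 c d e n i hi).symm.trans ht
      rw [← Option.some.inj h0]
      simp only [true_and]
      rfl

end MachineTiles

/-- A tiling problem that is undecidable in the length of the word at the start of the bottom row,
all but three of whose tiles are equal. -/
theorem exists_undecidable_tiling : ∃ (D : TileSystem) (s₀ s₁ z e : D.Tile),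
    ¬ ComputablePred fun n => D.Tiles (s₀ :: s₁ :: (List.replicate n z ++ [e])) := by
  obtain ⟨Γ, Λ, _, _, _, M, S, c, d, e, hM, hund⟩ := exists_turingMachine
  refine ⟨machineTiles M S,
    (⟨true, false, ⟨default, hM.1⟩, c, (c, default), (d, default)⟩ : MachineTile Γ S),
    (⟨false, false, ⟨default, hM.1⟩, c, (d, default), (e, default)⟩ : MachineTile Γ S),
    (⟨false, false, ⟨default, hM.1⟩, c, (e, default), (e, default)⟩ : MachineTile Γ S),
    (⟨false, true, ⟨default, hM.1⟩, c, (e, default), (default, default)⟩ : MachineTile Γ S),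
    fun h => hund ?_⟩
  refine h.not.of_eq fun n => ?_
  exact (not_congr (tiles_inputWord_iff hM c d e n)).trans not_not

/-! ### The reduction is computable -/

namespace Formula

theorem computable_neg : Computable Formula.neg := by
  have h : Primrec fun φ : Formula => 4 * Encodable.encode φ + 1 :=
    Primrec.succ.comp (Primrec.nat_mul.comp (Primrec.const 4) Primrec.encode)
  exact (Computable.encode_iff.1 (h.to_comp.of_eq fun φ => rfl))

theorem computable_and : Computable₂ Formula.and := by
  have h : Primrec fun p : Formula × Formula =>
      4 * Nat.pair (Encodable.encode p.1) (Encodable.encode p.2) + 2 :=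
    Primrec.nat_add.comp (Primrec.nat_mul.comp (Primrec.const 4)
      (Primrec₂.natPair.comp (Primrec.encode.comp Primrec.fst) (Primrec.encode.comp Primrec.snd)))
      (Primrec.const 2)
  exact (Computable.encode_iff.1 (h.to_comp.of_eq fun φ => rfl))

theorem computable_box (r : RCC8) : Computable (Formula.box r) := by
  have h : Primrec fun φ : Formula => 4 * (8 * Encodable.encode φ + r.toIndex) + 3 :=
    Primrec.nat_add.comp (Primrec.nat_mul.comp (Primrec.const 4)
      (Primrec.nat_add.comp (Primrec.nat_mul.comp (Primrec.const 8) Primrec.encode)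
        (Primrec.const _))) (Primrec.const 3)
  exact (Computable.encode_iff.1 (h.to_comp.of_eq fun φ => rfl))

theorem computable_imp (φ : Formula) : Computable (Formula.imp φ) :=
  computable_neg.comp (computable_and.comp (Computable.const φ) computable_neg)

theorem computable_boxLink (k : ℕ) : Computable (Formula.boxLink k) :=
  (computable_box _).comp <| (computable_imp _).comp <| (computable_box _).comp (computable_imp _)

end Formula

theorem TileSystem.computable_formula (D : TileSystem) (s₀ s₁ z e : D.Tile) :
    Computable fun n => D.formula (s₀ :: s₁ :: (List.replicate n z ++ [e])) := by
  classical
  have hcons : ∀ (t : D.Tile) (w : ℕ → List D.Tile),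
      Computable (fun n => D.wordFormula (w n)) → Computable fun n => D.wordFormula (t :: w n) :=
    fun t w hw => Formula.computable_and.comp (Computable.const _)
      ((Formula.computable_boxLink 2).comp hw)
  have hrep : Computable fun n => D.wordFormula (List.replicate n z ++ [e]) := by
    refine (Computable.nat_rec (f := fun n : ℕ => n) (g := fun _ => D.wordFormula [e])
      (h := fun _ p => Formula.and
        (.conj ((Finset.univ.filter fun t' => t' ≠ z).toList.map fun t' =>
          .neg (.var (D.tileVar t')))) (.boxLink 2 p.2))
      Computable.id (Computable.const _) ?_).of_eq fun n => ?_
    · exact (Formula.computable_and.comp (Computable.const _)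
        ((Formula.computable_boxLink 2).comp (Computable.snd.comp Computable.snd))).to₂
    · induction n with
      | zero => rfl
      | succ n ih =>
        rw [List.replicate_succ, List.cons_append]
        exact congrArg (fun φ => Formula.and _ (.boxLink 2 φ)) ih
  exact Formula.computable_and.comp (Computable.const _) (hcons _ _ (hcons _ _ hrep))

theorem undecidable_logic {S : Set RelStructure.{u}} (hS : S ⊆ RS)
    (hd : ∃ R ∈ S, DominoReady R) : Undecidable (logic S) := by
  intro h
  obtain ⟨D, s₀, s₁, z, e, hund⟩ := exists_undecidable_tiling
  refine hund ?_
  have hred : ComputablePred fun n =>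
      (D.formula (s₀ :: s₁ :: (List.replicate n z ++ [e]))).neg ∈ logic S :=
    ComputablePred.computable_of_manyOneReducible
      ⟨_, Formula.computable_neg.comp (D.computable_formula s₀ s₁ z e), fun _ => Iff.rfl⟩ h
  exact hred.not.of_eq fun n => by rw [neg_formula_mem_logic_iff hS hd, not_not]

theorem undecidable_logic_and_subLogic {S : Set RelStructure.{u}} (hS : S ⊆ RS)
    (hd : ∃ R ∈ S, DominoReady R) : Undecidable (logic S) ∧ Undecidable (subLogic S) :=
  ⟨undecidable_logic hS hd, undecidable_logic (substructures_subset_RS hS)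
    (exists_dominoReady_substructures hS hd)⟩

end RegionLogic

open RegionLogic
theorem theorem5p1 :
    -- the general form: any class of region structures with a domino ready member
    (∀ S : Set RelStructure.{u}, S ⊆ RS → (∃ R ∈ S, DominoReady R) →
      Undecidable (logic S) ∧ Undecidable (subLogic S)) ∧
    -- classes with a member of the form (up to isomorphism) `ℝⁿ` with all hyper-rectangles
    (∀ S : Set RelStructure.{u}, S ⊆ RS → ∀ n : ℕ, 0 < n →
      ∀ U : Set (Set (EuclideanSpace ℝ (Fin n))),
      U ⊆ regSets (EuclideanSpace ℝ (Fin n)) → rectSets n ⊆ U →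
      (∃ R ∈ S, R.Isomorphic (concrete U)) →
      Undecidable (logic S) ∧ Undecidable (subLogic S)) ∧
    -- the full and substructure logics of the standard classes and structures
    (Undecidable (logic RS.{u}) ∧ Undecidable (subLogic RS.{u})) ∧
    (Undecidable (logic TOP.{u}) ∧ Undecidable (subLogic TOP.{u})) ∧
    (∀ n : ℕ, 0 < n → ∀ U : Set (Set (EuclideanSpace ℝ (Fin n))),
      U = regSets (EuclideanSpace ℝ (Fin n)) ∨ U = convSets n ∨ U = rectSets n →
      Undecidable (logic {concrete U}) ∧ Undecidable (subLogic {concrete U})) := by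
  refine ⟨fun S => undecidable_logic_and_subLogic, ?_, ?_, ?_, ?_⟩
  · rintro S hS n hn U - hU ⟨R, hRS, hR⟩
    exact undecidable_logic_and_subLogic hS
      ⟨R, hRS, (dominoReady_of_rectSets_subset hn hU).of_isomorphic hR⟩
  · obtain ⟨R, hR, hd⟩ := exists_dominoReady_TOP.{u}
    exact undecidable_logic_and_subLogic subset_rfl ⟨R, TOP_subset_RS hR, hd⟩
  · exact undecidable_logic_and_subLogic TOP_subset_RS exists_dominoReady_TOP
  · intro n hn U hU
    have hreg : U ⊆ regSets (EuclideanSpace ℝ (Fin n)) := by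
      rcases hU with rfl | rfl | rfl
      · exact subset_rfl
      · exact fun s hs => hs.1
      · exact rectSets_subset_regSets
    have hrect : rectSets n ⊆ U := by
      rcases hU with rfl | rfl | rfl
      · exact rectSets_subset_regSets
      · exact rectSets_subset_convSets
      · exact subset_rfl
    have hd := dominoReady_of_rectSets_subset hn hrect
    have hne : U.Nonempty := hd.elim fun x _ => ⟨_, (x 0).2⟩
    exact undecidable_logic_and_subLogic
      (Set.singleton_subset_iff.2 (isRegionStructure_concrete hreg hne)) ⟨_, rfl, hd⟩
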